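/- **Notation.** For a group $G$ with a finite generating set $S$, $v_{G,S}(r)$ is the number of elements of $G$ that are products of at most $r$ elements of $S\cup S^{-1}$, and $\mathrm{Diam}(G,S)\in\mathbb N\cup\{\infty\}$ is the diameter of the Cayley graph. Let $\mathsf L_n=\{0,1\}^n$ be the $n$-th level of the rooted binary tree, and let $\mathfrak G=\langle a,b,c,d\rangle$ be the first Grigorchuk group acting on the tree, where $a$ exchanges the two subtrees of the root and $b,c,d$ are given by $b=(a,c)$, $c=(a,d)$, $d=(1,b)$ (the first entry acts on the subtree at $0$, the second on the subtree at $1$). Let $\eta\approx 0.811$ be the real root of $X^3+X^2+X-2$ and $\alpha_0=\log 2/\log(2/\eta)\approx 0.767$. Let $U,V$ be non-trivial finite groups, one of which has at least $3$ elements, and let $\mathcal L=(F_n)_{n\ge 1}$ be a sequence of quotients of $U*V$, each with the generating set formed by the images of the elements of $U$ and $V$, again denoted $U\cup V$. Let $\Delta_n=F_n\wr_{\mathsf L_n}\mathfrak G=F_n^{\mathsf L_n}\rtimes\mathfrak G$ be the permutation wreath product, marked by $T_n$, which consists of $a,b,c,d$, of the functions $\delta^{u}_{1^n}$ with $u\in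 U\setminus\{1\}$, and of the functions $\delta^{v}_{1^{n-1}0}$ with $v\in V\setminus\{1\}$ (here $\delta_x^{\gamma}$ takes the value $\gamma$, read in $F_n$, at $x$ and is trivial elsewhere). Let $(\Delta,T)$ be the diagonal product of the marked groups $(\Delta_n,T_n)_{n\ge 1}$, that is, the subgroup of $\prod_n\Delta_n$ generated by the diagonally embedded generators. For $r\in\mathbb N$ put $J_r=\{j\ge 1:\ r\ge(2/\eta)^j,\ F_j\ne\{1\}\}$. **Theorem (Volume growth of $\Delta$).** Suppose that there are a constant $C_0>1$ and a non-decreasing concave function $\Phi:\mathbb R_{\ge 0}\to\mathbb R_{\ge 0}$ with $\Phi(1)=1$ such that, for all $n\ge1$ and all integers $1\le\ell\le\mathrm{Diam}(F_n,U\cup V)$, $$\Phi(\ell)\ge\tfrac1{C_0}\log(1+\ell)\quad\text{and}\quad \tfrac{1}{C_0}\Phi(\ell)\le\log v_{F_n,U\cup V}(\ell)\le C_0\Phi(\ell).$$ Then there is a constant $C>0$, depending only on $C_0$ and $|U|+|V|$, such that for every $r\in\mathbb N$ $$\log v_{\Delta,T}(r)\le C\sum_{j\in J_r}2^j\,\Phi\Big(\min\big\{(\tfrac{\eta}{2})^j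 r,\ \mathrm{Diam}(F_j,U\cup V)\big\}\Big)+C\,r^{\alpha_0}$$ and $$\log v_{\Delta,T}(r)\ge \frac1C\max_{j\in J_r}2^j\,\Phi\Big(\min\big\{(\tfrac{\eta}{2})^j r,\ \mathrm{Diam}(F_j,U\cup V)\big\}\Big),$$ and, if $F_n\neq\{1\}$ for infinitely many $n$, moreover $$\log v_{\Delta,T}(r)\ge \frac1C\max_{j\in J_r}2^j\,\Phi\Big(\min\big\{(\tfrac{\eta}{2})^j r,\ \mathrm{Diam}(F_j,U\cup V)\big\}\Big)+\frac1C\,r^{\alpha_0}$$ (a maximum over the empty set is $0$). If $U$ and $V$ map injectively to every non-trivial $F_n$, then $C$ can be chosen to depend only on $C_0$. -/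

import Mathlib

namespace DiagProd

/-! ### Word metrics -/

section WordMetric

variable {G : Type*} [Group G]

/-- The ball of radius `r` around the identity in the word metric of `S`:
products of at most `r` elements of `S ∪ S⁻¹`. -/
def ball (S : Set G) (r : ℕ) : Set G :=
  {g | ∃ l : List G, l.length ≤ r ∧ (∀ s ∈ l, s ∈ S ∨ s⁻¹ ∈ S) ∧ l.prod = g}

/-- The volume growth function `v_{G,S}` (used for finite `S` only, so that balls are finite). -/
noncomputable def growth (S : Set G) (r : ℕ) : ℕ := (ball S r).ncard

/-- The word length with respect to a generating set `S`. -/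
noncomputable def wordLength (S : Set G) (g : G) : ℕ := sInf {r | g ∈ ball S r}

/-- The diameter of the Cayley graph of `(G, S)`, for a generating set `S`; it may be `⊤`. -/
noncomputable def diam (S : Set G) : ℕ∞ := ⨆ g : G, (wordLength S g : ℕ∞)

end WordMetric

/-- `min {x, D}` for a real `x` and a possibly infinite `D`. -/
noncomputable def minDiam (x : ℝ) (D : ℕ∞) : ℝ :=
  if D = ⊤ then x else min x (D.toNat : ℝ)

/-! ### Grigorchuk groups

Vertices of the rooted binary tree are finite words over `{0, 1}`, with `0 = false`, `1 = true`;
the first letter of a word is the one closest to the root. -/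

/-- The non-identity elements of the four-group `{id, b, c, d}`. -/
inductive Letter
  | b | c | d

/-- The homomorphisms `0, 1, 2` from `{id, b, c, d}` to `{id, a}` vanish on `d, c, b`
respectively; `vanishes i x` says that the homomorphism `i` sends `x` to the identity. -/
def vanishes : Fin 3 → Letter → Bool
  | 0, Letter.d => true
  | 1, Letter.c => true
  | 2, Letter.b => true
  | _, _ => false

/-- The automorphism `a = (id, id) ε`, which flips the first letter. -/
def aFun : List Bool → List Bool
  | [] => []
  | x :: v => (!x) :: v

/-- The automorphism `x_ω = (ω₀(x), x_{𝔰ω})`, for `x` one of `b, c, d`: it acts as `ω₀(x)` on the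
subtree at `0` and as `x_{𝔰ω}` on the subtree at `1`. -/
def letterFun : (ℕ → Fin 3) → Letter → List Bool → List Bool
  | _, _, [] => []
  | ω, x, true :: v => true :: letterFun (fun n => ω (n + 1)) x v
  | ω, x, false :: v => false :: (if vanishes (ω 0) x then v else aFun v)

theorem aFun_involutive : Function.Involutive aFun := by
  intro v
  cases v <;> simp [aFun]

theorem letterFun_involutive (ω : ℕ → Fin 3) (x : Letter) :
    Function.Involutive (letterFun ω x) := by
  intro v
  induction v generalizing ω with
  | nil => simp [letterFun]
  | cons y v ih =>
    cases y
    · by_cases h : vanishes (ω 0) x = true <;> simp [letterFun, h, aFun_involutive v]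
    · simp [letterFun, ih]

theorem length_aFun (v : List Bool) : (aFun v).length = v.length := by
  cases v <;> simp [aFun]

theorem length_letterFun (ω : ℕ → Fin 3) (x : Letter) (v : List Bool) :
    (letterFun ω x v).length = v.length := by
  induction v generalizing ω with
  | nil => simp [letterFun]
  | cons y v ih =>
    cases y
    · by_cases h : vanishes (ω 0) x = true <;> simp [letterFun, h, length_aFun]
    · simp [letterFun, ih]

/-- The generator `a` as a permutation of the vertices. -/
def aPerm : Equiv.Perm (List Bool) := aFun_involutive.toPerm

/-- The generators `b_ω, c_ω, d_ω` as permutations of the vertices. -/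
def letterPerm (ω : ℕ → Fin 3) (x : Letter) : Equiv.Perm (List Bool) :=
  (letterFun_involutive ω x).toPerm

/-- The Grigorchuk group `G_ω`. -/
def grigorchuk (ω : ℕ → Fin 3) : Subgroup (Equiv.Perm (List Bool)) :=
  Subgroup.closure (insert aPerm (Set.range (letterPerm ω)))

theorem length_smul {ω : ℕ → Fin 3} (g : Equiv.Perm (List Bool)) (hg : g ∈ grigorchuk ω)
    (v : List Bool) : (g v).length = v.length := by
  induction hg using Subgroup.closure_induction generalizing v with
  | mem g hg =>
    rcases hg with rfl | ⟨x, rfl⟩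
    · exact length_aFun v
    · exact length_letterFun ω x v
  | one => rfl
  | mul g h _ _ ihg ihh => rw [Equiv.Perm.mul_apply, ihg, ihh]
  | inv g _ ih => rw [← ih (g⁻¹ v), ← Equiv.Perm.mul_apply, mul_inv_cancel, Equiv.Perm.one_apply]

/-- The element `a` of `G_ω`. -/
def aGen (ω : ℕ → Fin 3) : grigorchuk ω :=
  ⟨aPerm, Subgroup.subset_closure (Set.mem_insert _ _)⟩

/-- The elements `b_ω, c_ω, d_ω` of `G_ω`. -/
def letterGen (ω : ℕ → Fin 3) (x : Letter) : grigorchuk ω :=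
  ⟨letterPerm ω x, Subgroup.subset_closure (Set.mem_insert_of_mem _ ⟨x, rfl⟩)⟩

/-- The `n`-th level of the tree. -/
abbrev Level (n : ℕ) : Type := {v : List Bool // v.length = n}

/-- The action of `G_ω` on the `n`-th level. It is written as a left action; the right action
is `x · g = g⁻¹ • x`, and the two agree on the generators `a, b, c, d`, which are involutions. -/
instance (ω : ℕ → Fin 3) (n : ℕ) : MulAction (grigorchuk ω) (Level n) where
  smul g v := ⟨(g : Equiv.Perm (List Bool)) v.1, by rw [length_smul _ g.2, v.2]⟩
  one_smul _ := rfl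
  mul_smul _ _ _ := rfl

/-- The vertex `1ⁿ`. -/
def vertexOnes (n : ℕ+) : Level n :=
  ⟨List.replicate (n : ℕ) true, List.length_replicate⟩

/-- The vertex `1ⁿ⁻¹0`. -/
def vertexOnesZero (n : ℕ+) : Level n :=
  ⟨List.replicate ((n : ℕ) - 1) true ++ [false], by
    have := n.pos
    simp only [List.length_append, List.length_replicate, List.length_singleton]
    omega⟩

/-! ### The factors and their diagonal product -/

/-- The permutation wreath product `L ≀ G_ω` over the `n`-th level. As the level is finite,
all functions on it are finitely supported. The product is
`(f₁, g₁) (f₂, g₂) = (f₁ (g₁ · f₂), g₁ g₂)` with `(g · f) x = f (g⁻¹ • x) = f (x · g)`. -/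
abbrev Wreath (ω : ℕ → Fin 3) (n : ℕ) (L : Type*) [Group L] : Type _ :=
  (Level n → L) ⋊[(mulAutArrow : grigorchuk ω →* MulAut (Level n → L))] grigorchuk ω

/-- Index set of the markings: the letters `a, b, c, d` and the non-identity elements
of `U` and of `V`. -/
inductive Gen (U V : Type*) [Group U] [Group V]
  | a : Gen U V
  | letter (x : Letter) : Gen U V
  | inU (u : U) (hu : u ≠ 1) : Gen U V
  | inV (v : V) (hv : v ≠ 1) : Gen U V

section Diagonal

variable {U V : Type*} [Group U] [Group V] {F : ℕ+ → Type*} [∀ n, Group (F n)]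

/-- The marking `T_n` of `Δ_n = F_n ≀ G_ω`: the generators of `G_ω`, the elements of `U` as lamps
at `1ⁿ`, and the elements of `V` as lamps at `1ⁿ⁻¹0`. -/
def marking (ω : ℕ → Fin 3) (π : ∀ n, Monoid.Coprod U V →* F n) (n : ℕ+) :
    Gen U V → Wreath ω n (F n)
  | Gen.a => SemidirectProduct.inr (aGen ω)
  | Gen.letter x => SemidirectProduct.inr (letterGen ω x)
  | Gen.inU u _ =>
      SemidirectProduct.inl (Pi.mulSingle (vertexOnes n) (π n (Monoid.Coprod.inl u)))
  | Gen.inV v _ =>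
      SemidirectProduct.inl (Pi.mulSingle (vertexOnesZero n) (π n (Monoid.Coprod.inr v)))

/-- The diagonal product `Δ(ℒ, ω)` of the marked groups `(Δ_n, T_n)`, `n ≥ 1`. -/
def Delta (ω : ℕ → Fin 3) (π : ∀ n, Monoid.Coprod U V →* F n) :
    Subgroup (∀ n : ℕ+, Wreath ω n (F n)) :=
  Subgroup.closure (Set.range fun s n => marking ω π n s)

/-- The marking `T` of `Δ(ℒ, ω)`. -/
def deltaMarking (ω : ℕ → Fin 3) (π : ∀ n, Monoid.Coprod U V →* F n) (s : Gen U V) :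
    Delta ω π :=
  ⟨fun n => marking ω π n s, Subgroup.subset_closure ⟨s, rfl⟩⟩

/-- The sequence `(012)^∞`. -/
def omega012 (n : ℕ) : Fin 3 := ⟨n % 3, Nat.mod_lt n (by norm_num)⟩

/-- The growth function `v_{Δ,T}` of `Δ = Δ(ℒ, (012)^∞)`. -/
noncomputable def deltaGrowth (π : ∀ n, Monoid.Coprod U V →* F n) (r : ℕ) : ℕ :=
  growth (Set.range (deltaMarking omega012 π)) r

/-- The generating set `U ∪ V` of the marked quotient `F_n` of `U * V`. -/
def lampGens (π : ∀ n, Monoid.Coprod U V →* F n) (n : ℕ+) : Set (F n) :=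
  Set.range (fun u : U => π n (Monoid.Coprod.inl u)) ∪
    Set.range (fun v : V => π n (Monoid.Coprod.inr v))

/-- The uniform growth assumption on the sequence `ℒ = (F_n)`, with function `Φ : ℝ≥0 → ℝ≥0`
and constant `C₀`. -/
structure GrowthAssumption (C₀ : ℝ) (Φ : ℝ → ℝ) (π : ∀ n, Monoid.Coprod U V →* F n) :
    Prop where
  nonneg : ∀ x, 0 ≤ x → 0 ≤ Φ x
  mono : MonotoneOn Φ (Set.Ici 0)
  concave : ConcaveOn ℝ (Set.Ici 0) Φ
  map_one : Φ 1 = 1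
  log_le : ∀ (n : ℕ+) (l : ℕ), 1 ≤ l → (l : ℕ∞) ≤ diam (lampGens π n) →
    1 / C₀ * Real.log (1 + l) ≤ Φ l
  lower : ∀ (n : ℕ+) (l : ℕ), 1 ≤ l → (l : ℕ∞) ≤ diam (lampGens π n) →
    Φ l / C₀ ≤ Real.log (growth (lampGens π n) l)
  upper : ∀ (n : ℕ+) (l : ℕ), 1 ≤ l → (l : ℕ∞) ≤ diam (lampGens π n) →
    Real.log (growth (lampGens π n) l) ≤ C₀ * Φ l

/-- The index set `J_r(ℒ)`. It is finite, as `2 / η > 1`. -/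
def indexSet (η : ℝ) (F : ℕ+ → Type*) (r : ℕ) : Set ℕ+ :=
  {j | (2 / η) ^ (j : ℕ) ≤ (r : ℝ) ∧ Nontrivial (F j)}

/-- The term `2^j Φ(min {(η/2)^j r, Diam(F_j, U ∪ V)})`. -/
noncomputable def term (η : ℝ) (Φ : ℝ → ℝ) (π : ∀ n, Monoid.Coprod U V →* F n) (r : ℕ)
    (j : ℕ+) : ℝ :=
  2 ^ (j : ℕ) * Φ (minDiam ((η / 2) ^ (j : ℕ) * r) (diam (lampGens π j)))

/-- The exponent `α₀ = log 2 / log (2 / η)`. -/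
noncomputable def alpha0 (η : ℝ) : ℝ := Real.log 2 / Real.log (2 / η)

/-- The bounds on the growth of `Δ` with constant `C`, for all radii `r`. A maximum over the
empty index set is `0`, which is also the value of `⨆` in `ℝ` over an empty type. -/
def VolumeBounds (η C : ℝ) (Φ : ℝ → ℝ) (π : ∀ n, Monoid.Coprod U V →* F n) : Prop :=
  ∀ r : ℕ,
    Real.log (deltaGrowth π r) ≤
        C * (∑ᶠ j ∈ indexSet η F r, term η Φ π r j) + C * (r : ℝ) ^ alpha0 η ∧
    1 / C * (⨆ j : indexSet η F r, term η Φ π r j) ≤ Real.log (deltaGrowth π r) ∧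
    ({n : ℕ+ | Nontrivial (F n)}.Infinite →
      1 / C * (⨆ j : indexSet η F r, term η Φ π r j) + 1 / C * (r : ℝ) ^ alpha0 η ≤
        Real.log (deltaGrowth π r))

end Diagonal

end DiagProd

namespace DiagProd

/-! An element of length at most `r` is written as a word `s₀ a s₁ a ⋯ a sₘ` whose syllables combine
an element of `{1, b, c, d}` with lamps `(u, v)`. The letters `b, c, d` fix both lamp positions `1ⁿ`
and `1ⁿ⁻¹0` of level `n`, so lamps and letters commute within a syllable. The two first-level
sections of a word are again such words, and they compute its lamps with the level lowered by one
(`AltWord.conf_sec`). For a suitable weighted length, the two sections together are shorter by the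
factor `η`, up to an additive constant (`AltWord.norm_sec_add_le`). Hence the sections on level `k`
have total length `O(η^k r + 2^k)`.

Upper bound. If `(2/η)^j ≤ r`, the lamp values on level `j` have total word length `O(2^j t)` with
`t = (η/2)^j r`. A generating function estimate using the concavity of `Φ` allows `exp(O(2^j
Φ(min{t, Diam})))` such configurations (`GrowthAssumption.exists_finset_config`). Let `k` be maximal
with `(2/η)^k ≤ r`. The sections on level `k` then have total length `O(2^k)`, so together with the
portrait above them they take `exp(O(2^k))` values, and `2^k ≤ r^α₀` because `(2/η)^α₀ = 2`. These
data, with the lamps on the levels in `J_r`, determine the element (`eq_of_represents`).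

Lower bound. A substitution multiplies lengths by about `2/η` and lets lamps along two copies of a
word be chosen independently one level deeper (`exists_lampConf_subst`), so the number of
configurations is squared. Starting on level `1` with words that realise a ball of `F_j` gives the
term for `j`; starting with a single lamp on a level whose group is non-trivial gives `r^α₀`.

Beyond `C₀`, the constant depends only on the number of syllables, at most `4 |U| |V|`. If `U` and
`V` embed in a non-trivial `F_n`, the growth assumption at radius `1` bounds their orders by `exp
C₀`. -/

/-! ### Self-similarity of the first Grigorchuk group -/

/-- The rotation of the letters given by the section at `1`: `b = (a, c)`, `c = (a, d)`,
`d = (1, b)`. -/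
def Letter.next : Letter → Letter
  | Letter.b => Letter.c
  | Letter.c => Letter.d
  | Letter.d => Letter.b

theorem letterFun_congr {ω ω' : ℕ → Fin 3} {x x' : Letter}
    (h : ∀ n, vanishes (ω n) x = vanishes (ω' n) x') (v : List Bool) :
    letterFun ω x v = letterFun ω' x' v := by
  induction v generalizing ω ω' with
  | nil => simp [letterFun]
  | cons i v ih =>
    cases i
    · simp [letterFun, h 0]
    · simp only [letterFun]
      rw [ih (fun n => h (n + 1))]

/-- The period of `(012)^∞` turns a shift of the sequence into a rotation of the letters; this keeps
all sections inside one group. -/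
theorem vanishes_omega012_succ (n : ℕ) (x : Letter) :
    vanishes (omega012 (n + 1)) x = vanishes (omega012 n) x.next := by
  have h : n % 3 = 0 ∨ n % 3 = 1 ∨ n % 3 = 2 := by omega
  rcases h with h | h | h
  · have h0 : omega012 n = 0 := Fin.ext h
    have h1 : omega012 (n + 1) = 1 := Fin.ext (show (n + 1) % 3 = 1 by omega)
    rw [h0, h1]; cases x <;> rfl
  · have h0 : omega012 n = 1 := Fin.ext h
    have h1 : omega012 (n + 1) = 2 := Fin.ext (show (n + 1) % 3 = 2 by omega)
    rw [h0, h1]; cases x <;> rfl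
  · have h0 : omega012 n = 2 := Fin.ext h
    have h1 : omega012 (n + 1) = 0 := Fin.ext (show (n + 1) % 3 = 0 by omega)
    rw [h0, h1]; cases x <;> rfl

/-- The action of an element of the four-group `{1, b, c, d}` on the vertices. -/
def optFun : Option Letter → List Bool → List Bool
  | none, v => v
  | some x, v => letterFun omega012 x v

/-- Whether the section at `0` of an element of `{1, b, c, d}` is `a`. -/
def flips : Option Letter → Bool
  | some Letter.b => true
  | some Letter.c => true
  | _ => false

/-- Multiplication in the four-group `{1, b, c, d}`. -/
def kmul : Option Letter → Option Letter → Option Letter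
  | none, y => y
  | x, none => x
  | some Letter.b, some Letter.b => none
  | some Letter.b, some Letter.c => some Letter.d
  | some Letter.b, some Letter.d => some Letter.c
  | some Letter.c, some Letter.b => some Letter.d
  | some Letter.c, some Letter.c => none
  | some Letter.c, some Letter.d => some Letter.b
  | some Letter.d, some Letter.b => some Letter.c
  | some Letter.d, some Letter.c => some Letter.b
  | some Letter.d, some Letter.d => none

@[simp] theorem optFun_nil (x : Option Letter) : optFun x [] = [] := by
  cases x <;> simp [optFun, letterFun]

@[simp] theorem optFun_none (v : List Bool) : optFun none v = v := rfl

@[simp] theorem optFun_true (x : Option Letter) (v : List Bool) :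
    optFun x (true :: v) = true :: optFun (x.map Letter.next) v := by
  cases x with
  | none => rfl
  | some x =>
    simp only [optFun, letterFun, Option.map_some]
    rw [letterFun_congr (fun n => vanishes_omega012_succ n x)]

@[simp] theorem optFun_false (x : Option Letter) (v : List Bool) :
    optFun x (false :: v) = false :: (if flips x then aFun v else v) := by
  have h0 : omega012 0 = 0 := rfl
  rcases x with _ | _ | _ | _ <;> simp [optFun, letterFun, flips, h0, vanishes]

@[simp] theorem aFun_cons (i : Bool) (v : List Bool) : aFun (i :: v) = (!i) :: v := rfl

@[simp] theorem aFun_nil : aFun [] = [] := rfl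

@[simp] theorem aFun_aFun (v : List Bool) : aFun (aFun v) = v := aFun_involutive v

theorem optFun_kmul (x y : Option Letter) (v : List Bool) :
    optFun (kmul x y) v = optFun y (optFun x v) := by
  induction v generalizing x y with
  | nil => simp
  | cons i v ih =>
    cases i
    · rcases x with _ | _ | _ | _ <;> rcases y with _ | _ | _ | _ <;> simp [kmul, flips]
    · have : (kmul x y).map Letter.next = kmul (x.map Letter.next) (y.map Letter.next) := by
        rcases x with _ | _ | _ | _ <;> rcases y with _ | _ | _ | _ <;> rfl
      simp [this, ih]

/-! ### Lamps -/

section Lamps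

variable {M F : Type*} [Group M] [Group F]

/-- The configuration on level `k + 1` with the lamp `p` at `1ᵏ1` and the lamp `q` at `1ᵏ0`. -/
def lampF (p q : F) : ℕ → List Bool → F
  | 0, [true] => p
  | 0, [false] => q
  | k + 1, true :: x => lampF p q k x
  | _, _ => 1

@[simp] theorem lampF_zero_true (p q : F) : lampF p q 0 [true] = p := rfl

@[simp] theorem lampF_zero_false (p q : F) : lampF p q 0 [false] = q := rfl

@[simp] theorem lampF_nil (p q : F) (k : ℕ) : lampF p q k [] = 1 := by
  cases k <;> rfl

@[simp] theorem lampF_zero_cons_cons (p q : F) (i j : Bool) (x : List Bool) :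
    lampF p q 0 (i :: j :: x) = 1 := by
  cases i <;> rfl

@[simp] theorem lampF_succ_true (p q : F) (k : ℕ) (x : List Bool) :
    lampF p q (k + 1) (true :: x) = lampF p q k x := rfl

@[simp] theorem lampF_succ_false (p q : F) (k : ℕ) (x : List Bool) :
    lampF p q (k + 1) (false :: x) = 1 := rfl

@[simp] theorem lampF_one (k : ℕ) (x : List Bool) : lampF (1 : F) 1 k x = 1 := by
  induction k generalizing x with
  | zero => rcases x with _ | ⟨_ | _, _ | ⟨j, x⟩⟩ <;> simp
  | succ k ih => rcases x with _ | ⟨_ | _, x⟩ <;> simp [ih]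

theorem lampF_mul (p q p' q' : F) (k : ℕ) (x : List Bool) :
    lampF (p * p') (q * q') k x = lampF p q k x * lampF p' q' k x := by
  induction k generalizing x with
  | zero => rcases x with _ | ⟨_ | _, _ | ⟨j, x⟩⟩ <;> simp
  | succ k ih => rcases x with _ | ⟨_ | _, x⟩ <;> simp [ih]

-- Both lamp positions `1ᵏ1` and `1ᵏ0` are fixed by `b, c, d`: below `1ᵏ0` a section `a` meets only
-- the empty word. Therefore the lamps of merged syllables simply multiply.
@[simp] theorem lampF_optFun (p q : F) (k : ℕ) (l : Option Letter) (x : List Bool) :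
    lampF p q k (optFun l x) = lampF p q k x := by
  induction k generalizing x l with
  | zero =>
    rcases x with _ | ⟨_ | _, _ | ⟨_ | _, x⟩⟩ <;> simp <;> split_ifs <;> simp
  | succ k ih => rcases x with _ | ⟨_ | _, x⟩ <;> simp [ih]

end Lamps

/-! ### Alternating words and their sections -/

/-- Alternating words `s₀ a s₁ a ⋯ a sₘ`, whose syllables are products of an element of
`{1, b, c, d}` and an element of the lamp group `M`. -/
inductive AltWord (M : Type*)
  | single (s : Option Letter × M) : AltWord M
  | cons (s : Option Letter × M) (w : AltWord M) : AltWord M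

namespace AltWord

section

variable {M : Type*}

/-- The number of syllables. -/
def len : AltWord M → ℕ
  | single _ => 1
  | cons _ w => w.len + 1

/-- The parity of the number of letters `a`. -/
def parity : AltWord M → Bool
  | single _ => false
  | cons _ w => !w.parity

/-- The inverse of the tree automorphism given by a word. -/
def actInv : AltWord M → List Bool → List Bool
  | single s, x => optFun s.1 x
  | cons s w, x => actInv w (aFun (optFun s.1 x))

theorem actInv_nil (w : AltWord M) : actInv w [] = [] := by
  induction w with
  | single s => simp [actInv]
  | cons s w ih => simp [actInv, ih]

end

variable {M F : Type*} [Group M] [Group F]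

/-- Left multiplication by a syllable. -/
def mulHead (l : Option Letter) (m : M) : AltWord M → AltWord M
  | single s => single (kmul l s.1, m * s.2)
  | cons s w => cons (kmul l s.1, m * s.2) w

/-- The sections of a word at the vertices of the first level. -/
def sec : Bool → AltWord M → AltWord M
  | true, single s => single (s.1.map Letter.next, s.2)
  | false, single s => if flips s.1 then cons (none, 1) (single (none, 1)) else single (none, 1)
  | true, cons s w => mulHead (s.1.map Letter.next) s.2 (sec false w)
  | false, cons s w => if flips s.1 then cons (none, 1) (sec true w) else sec true w

/-- The section of a word at a vertex. -/
def secAt : List Bool → AltWord M → AltWord M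
  | [], w => w
  | i :: y, w => secAt y (sec i w)

/-- The lamp configuration of a word on level `k + 1`. -/
def conf (p q : M →* F) (k : ℕ) : AltWord M → List Bool → F
  | single s, x => lampF (p s.2) (q s.2) k x
  | cons s w, x => lampF (p s.2) (q s.2) k x * conf p q k w (aFun (optFun s.1 x))

theorem conf_mulHead (p q : M →* F) (k : ℕ) (l : Option Letter) (m : M) (w : AltWord M)
    (x : List Bool) :
    conf p q k (mulHead l m w) x = lampF (p m) (q m) k x * conf p q k w (optFun l x) := by
  cases w <;> simp [mulHead, conf, lampF_mul, optFun_kmul, mul_assoc]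

theorem actInv_mulHead (l : Option Letter) (m : M) (w : AltWord M) (x : List Bool) :
    actInv (mulHead l m w) x = actInv w (optFun l x) := by
  cases w <;> simp [mulHead, actInv, optFun_kmul]

theorem conf_cons_one (p q : M →* F) (k : ℕ) (w : AltWord M) (x : List Bool) :
    conf p q k (cons (none, 1) w) x = conf p q k w (aFun x) := by
  simp [conf]

/-- Each `a` switches the subtree. A syllable met in the subtree at `1` contributes its lamps and
its rotated letter; one met at `0` contributes no lamp, and an `a` or nothing. This is the recursion
defining `sec`. -/
theorem conf_sec (p q : M →* F) (k : ℕ) (i : Bool) (w : AltWord M) (x : List Bool) :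
    conf p q (k + 1) w (i :: x) = conf p q k (sec i w) x := by
  induction w generalizing i x with
  | single s => cases i <;> simp [sec, conf]; split_ifs <;> simp [conf]
  | cons s w ih =>
    cases i
    · simp only [sec, conf, optFun_false, aFun_cons, Bool.not_false, ih, lampF_succ_false, one_mul]
      split_ifs <;> simp [conf]
    · simp [sec, conf, conf_mulHead, ih]

theorem actInv_sec (i : Bool) (w : AltWord M) (x : List Bool) :
    actInv w (i :: x) = (i ^^ w.parity) :: actInv (sec i w) x := by
  induction w generalizing i x with
  | single s => cases i <;> simp [sec, actInv, parity]; split_ifs <;> simp [actInv]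
  | cons s w ih =>
    cases i
    · simp only [sec, actInv, optFun_false, aFun_cons, Bool.not_false, ih, parity]
      split_ifs <;> simp [actInv]
    · simp [sec, actInv, actInv_mulHead, ih, parity]

/-- The automorphism and the lamps below level `k` are determined by the portrait down to
level `k` and the sections on that level. -/
theorem actInv_eq_of_secAt (k : ℕ) {w w' : AltWord M}
    (hb : ∀ y : List Bool, y.length < k → (secAt y w).parity = (secAt y w').parity)
    (hs : ∀ y : List Bool, y.length = k → secAt y w = secAt y w') (x : List Bool) :
    actInv w x = actInv w' x := by
  induction k generalizing w w' x with
  | zero => rw [show w = w' from hs [] rfl]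
  | succ k ih =>
    cases x with
    | nil => simp [actInv_nil]
    | cons i x =>
      rw [actInv_sec, actInv_sec, show w.parity = w'.parity from hb [] (by simp),
        ih (w := sec i w) (w' := sec i w') (fun y hy => hb (i :: y) (by simpa using hy))
          (fun y hy => hs (i :: y) (by simpa using hy))]

/-- A lamp on level `m + 1 > k` is read off from the section at its ancestor on level `k`, so the
portrait above is not needed. -/
theorem conf_eq_of_secAt (p q : M →* F) (k m : ℕ) {w w' : AltWord M} (hkm : k ≤ m)
    (hs : ∀ y : List Bool, y.length = k → secAt y w = secAt y w') (x : List Bool)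
    (hx : x.length = m + 1) : conf p q m w x = conf p q m w' x := by
  induction k generalizing w w' x m with
  | zero => rw [show w = w' from hs [] rfl]
  | succ k ih =>
    obtain ⟨m, rfl⟩ : ∃ m', m = m' + 1 := ⟨m - 1, by omega⟩
    cases x with
    | nil => simp at hx
    | cons i x =>
      rw [conf_sec, conf_sec]
      exact ih m (by omega) (fun y hy => hs (i :: y) (by simpa using hy)) x (by simpa using hx)

/-! ### Contraction -/

/-- The weights of `1, b, c, d`. -/
def wt (η : ℝ) : Option Letter → ℝ
  | none => 0
  | some Letter.b => 2 - η - η ^ 2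
  | some Letter.c => 1 - η ^ 2
  | some Letter.d => 1 - η

/-- The weight of the letter `a`. -/
def wtA (η : ℝ) : ℝ := η ^ 2 + η - 1

/-- The weighted length of a word. -/
def norm (η : ℝ) : AltWord M → ℝ
  | single s => wt η s.1
  | cons s w => wt η s.1 + wtA η + norm η w

end AltWord

theorem root_bounds {η : ℝ} (hη : η ^ 3 + η ^ 2 + η - 2 = 0) : 4 / 5 < η ∧ η < 41 / 50 := by
  constructor
  · by_contra h
    push Not at h
    nlinarith [sq_nonneg (η + 1), sq_nonneg η, sq_nonneg (η + 9 / 10)]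
  · by_contra h
    push Not at h
    nlinarith [sq_nonneg (η + 1), sq_nonneg η, sq_nonneg (η + 9 / 10)]

namespace AltWord

variable {M : Type*} {η : ℝ}

theorem wtA_lower (hη : η ^ 3 + η ^ 2 + η - 2 = 0) : 11 / 25 ≤ wtA η := by
  have := root_bounds hη
  unfold wtA
  nlinarith

@[simp] theorem wt_none : wt η none = 0 := rfl

theorem wt_nonneg (hη : η ^ 3 + η ^ 2 + η - 2 = 0) (l : Option Letter) : 0 ≤ wt η l := by
  have := root_bounds hη
  rcases l with _ | _ | _ | _ <;> simp only [wt] <;> nlinarith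

theorem wt_kmul_le (hη : η ^ 3 + η ^ 2 + η - 2 = 0) (l l' : Option Letter) :
    wt η (kmul l l') ≤ wt η l + wt η l' := by
  have := root_bounds hη
  rcases l with _ | _ | _ | _ <;> rcases l' with _ | _ | _ | _ <;> simp only [wt, kmul] <;>
    nlinarith

/-- There is one syllable more than there are letters `a`, which accounts for the extra `wtA η`. -/
theorem len_le (hη : η ^ 3 + η ^ 2 + η - 2 = 0) (w : AltWord M) :
    wtA η * (w.len : ℝ) ≤ norm η w + wtA η := by
  induction w with
  | single s => have := wt_nonneg hη s.1; simp [len, norm, this]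
  | cons s w ih =>
    have := wt_nonneg hη s.1
    simp only [len, norm]
    push_cast
    linarith

variable [Group M]

theorem norm_mulHead_le (hη : η ^ 3 + η ^ 2 + η - 2 = 0) (l : Option Letter) (m : M)
    (w : AltWord M) : norm η (mulHead l m w) ≤ wt η l + norm η w := by
  cases w with
  | single s => exact wt_kmul_le hη l s.1
  | cons s w =>
    have := wt_kmul_le hη l s.1
    simp only [mulHead, norm]
    linarith

/-- The weights are chosen to give equality for `b`, `c` and `d`; for `d` this is the cubic equation
`η³ = 2 - η - η²`. -/
theorem wt_section_le (hη : η ^ 3 + η ^ 2 + η - 2 = 0) (l : Option Letter) :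
    wt η (l.map Letter.next) + (if flips l then wtA η else 0) ≤ η * (wtA η + wt η l) := by
  have := root_bounds hη
  rcases l with _ | _ | _ | _ <;> simp [wt, wtA, flips, Letter.next] <;> nlinarith

/-- Every syllable sends one section to each child, so `wt_section_le` can be added up over pairs of
a syllable and an `a`. The summand `wtA η` supplies the missing `a` after the last syllable. -/
theorem norm_sec_add_le (hη : η ^ 3 + η ^ 2 + η - 2 = 0) (w : AltWord M) :
    norm η (sec true w) + norm η (sec false w) ≤ η * (norm η w + wtA η) := by
  induction w with
  | single s =>
    have h := wt_section_le hη s.1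
    simp only [sec, norm]
    split_ifs with hf <;> simp [hf, norm] at h ⊢ <;> linarith
  | cons s w ih =>
    have h := wt_section_le hη s.1
    have h' := norm_mulHead_le hη (s.1.map Letter.next) s.2 (sec false w)
    simp only [sec, norm]
    split_ifs with hf <;> simp [hf, norm] at h ⊢ <;> linarith

end AltWord

/-! ### Sums over the levels of the tree -/

instance (k : ℕ) : Fintype (Level k) := inferInstanceAs (Fintype (List.Vector Bool k))

theorem card_level (k : ℕ) : Fintype.card (Level k) = 2 ^ k :=
  (card_vector (α := Bool) k).trans (by simp)

/-- A vertex of level `k + 1` is a vertex of level `1` followed by one of level `k`. -/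
def levelCons (k : ℕ) : Bool × Level k ≃ Level (k + 1) where
  toFun z := ⟨z.1 :: z.2.1, by simp [z.2.2]⟩
  invFun x := (x.1.head (by intro h; simpa [h] using x.2), ⟨x.1.tail, by simp [x.2]⟩)
  left_inv z := rfl
  right_inv x := by ext1; simp

theorem sum_level_succ (k : ℕ) (f : List Bool → ℝ) :
    ∑ x : Level (k + 1), f x.1 =
      ∑ x : Level k, f (true :: x.1) + ∑ x : Level k, f (false :: x.1) := by
  rw [← (levelCons k).sum_comp, Fintype.sum_prod_type, Fintype.sum_bool]
  rfl

theorem sum_level_zero (f : List Bool → ℝ) : ∑ x : Level 0, f x.1 = f [] := by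
  have : (Finset.univ : Finset (Level 0)) = {⟨[], rfl⟩} := by
    ext x; simp [Subtype.ext_iff, List.eq_nil_of_length_eq_zero x.2]
  rw [this, Finset.sum_singleton]

namespace AltWord

variable {M F : Type*} [Group M] [Group F] {η : ℝ}

/-- Iterated contraction. The error is kept in the form `2^k - η^k` so that the induction closes;
the step uses only `η ≤ 1` there. -/
theorem sum_norm_secAt_le (hη : η ^ 3 + η ^ 2 + η - 2 = 0) (k : ℕ) (w : AltWord M) :
    ∑ y : Level k, norm η (secAt y.1 w) ≤ η ^ k * norm η w + wtA η * (2 ^ k - η ^ k) := by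
  induction k generalizing w with
  | zero => rw [sum_level_zero (fun y => norm η (secAt y w))]; simp [secAt]
  | succ k ih =>
    rw [sum_level_succ k (fun y => norm η (secAt y w))]
    have h1 := ih (sec true w)
    have h0 := ih (sec false w)
    have h := norm_sec_add_le hη w
    have hb := root_bounds hη
    have ha := wtA_lower hη
    have hp : 0 < η ^ k := by apply pow_pos; linarith
    have h2 := mul_le_mul_of_nonneg_left h hp.le
    have h3 : 0 ≤ η ^ k * (wtA η * (1 - η)) := by
      apply mul_nonneg hp.le; apply mul_nonneg <;> linarith
    simp only [secAt]
    rw [pow_succ, pow_succ]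
    nlinarith

theorem sum_len_secAt_le (hη : η ^ 3 + η ^ 2 + η - 2 = 0) (k : ℕ) (w : AltWord M) :
    ∑ y : Level k, ((secAt y.1 w).len : ℝ) ≤ η ^ k * norm η w / wtA η + 2 * 2 ^ k := by
  have ha := wtA_lower hη
  have hb := root_bounds hη
  have hp : 0 < η ^ k := by apply pow_pos; linarith
  have h1 : wtA η * ∑ y : Level k, ((secAt y.1 w).len : ℝ)
      ≤ ∑ y : Level k, norm η (secAt y.1 w) + 2 ^ k * wtA η := by
    rw [Finset.mul_sum]
    refine (Finset.sum_le_sum fun y _ => len_le hη _).trans ?_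
    rw [Finset.sum_add_distrib]
    simp [card_level]
  have h2 := sum_norm_secAt_le hη k w
  have ha' : 0 < wtA η := by linarith
  rw [div_add' _ _ _ ha'.ne', le_div_iff₀ ha']
  nlinarith

/-! ### Lengths of lamps -/

/-- On level `1` each syllable contributes exactly one of its two lamps to a given vertex, so one
generator per syllable suffices. -/
theorem conf_zero_mem_ball (p q : M →* F) (S : Set F) (hp : ∀ m, p m ∈ S) (hq : ∀ m, q m ∈ S)
    (w : AltWord M) (i : Bool) : conf p q 0 w [i] ∈ ball S w.len := by
  induction w generalizing i with
  | single s =>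
    refine ⟨[conf p q 0 (single s) [i]], by simp [len], ?_, by simp⟩
    intro t ht
    left
    rw [List.mem_singleton.1 ht]
    cases i <;> simp [conf, hp, hq]
  | cons s w ih =>
    obtain ⟨l, hl, hS, hprod⟩ := ih (!i)
    refine ⟨lampF (p s.2) (q s.2) 0 [i] :: l, by simpa [len] using hl, ?_, ?_⟩
    · intro t ht
      rcases List.mem_cons.1 ht with rfl | ht
      · left; cases i <;> simp [hp, hq]
      · exact hS t ht
    · rw [List.prod_cons, hprod]
      cases i <;> simp [conf]

theorem wordLength_conf_zero_le (p q : M →* F) (S : Set F) (hp : ∀ m, p m ∈ S)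
    (hq : ∀ m, q m ∈ S) (w : AltWord M) (i : Bool) :
    wordLength S (conf p q 0 w [i]) ≤ w.len :=
  Nat.sInf_le (conf_zero_mem_ball p q S hp hq w i)

theorem sum_wordLength_conf_le (p q : M →* F) (S : Set F) (hp : ∀ m, p m ∈ S)
    (hq : ∀ m, q m ∈ S) (k : ℕ) (w : AltWord M) :
    ∑ x : Level (k + 1), (wordLength S (conf p q k w x.1) : ℝ) ≤
      2 * ∑ y : Level k, ((secAt y.1 w).len : ℝ) := by
  induction k generalizing w with
  | zero =>
    rw [sum_level_succ 0 (fun x => (wordLength S (conf p q 0 w x) : ℝ)),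
      sum_level_zero (fun x => (wordLength S (conf p q 0 w (true :: x)) : ℝ)),
      sum_level_zero (fun x => (wordLength S (conf p q 0 w (false :: x)) : ℝ)),
      -- The factor `2` counts the two children of a vertex, both controlled by the length of its
      -- section.
      sum_level_zero (fun y => ((secAt y w).len : ℝ)), two_mul]
    exact add_le_add (by exact_mod_cast wordLength_conf_zero_le p q S hp hq w true)
      (by exact_mod_cast wordLength_conf_zero_le p q S hp hq w false)
  | succ k ih =>
    rw [sum_level_succ (k + 1) (fun x => (wordLength S (conf p q (k + 1) w x) : ℝ)),
      sum_level_succ k (fun y => ((secAt y w).len : ℝ)), mul_add]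
    simp only [conf_sec, secAt]
    exact add_le_add (ih (sec true w)) (ih (sec false w))

end AltWord

/-! ### Representation of the elements of the diagonal product by alternating words -/

theorem lampF_eq {F : Type*} [Group F] (p q : F) (k : ℕ) (x : List Bool) :
    lampF p q k x = (if x = List.replicate (k + 1) true then p else 1) *
      (if x = List.replicate k true ++ [false] then q else 1) := by
  induction k generalizing x with
  | zero => rcases x with _ | ⟨_ | _, _ | ⟨j, x⟩⟩ <;> simp
  | succ k ih =>
    rcases x with _ | ⟨_ | _, x⟩
    · simp
    · simp [List.replicate_succ]
    · simp [List.replicate_succ, ih]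

section Representation

variable {U V M : Type*} [Group U] [Group V] [Group M] {F : ℕ+ → Type*} [∀ n, Group (F n)]

/-- The inverse tree automorphism of an element of a wreath product, on words. -/
def rightInv {n : ℕ} {L : Type*} [Group L] (h : Wreath omega012 n L) (v : List Bool) :
    List Bool :=
  (((h.right)⁻¹ : grigorchuk omega012) : Equiv.Perm (List Bool)) v

theorem rightInv_mul {n : ℕ} {L : Type*} [Group L] (g h : Wreath omega012 n L) (v : List Bool) :
    rightInv (g * h) v = rightInv h (rightInv g v) := by
  simp [rightInv, SemidirectProduct.mul_right, mul_inv_rev]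

theorem length_rightInv {n : ℕ} {L : Type*} [Group L] (h : Wreath omega012 n L)
    (v : List Bool) : (rightInv h v).length = v.length :=
  length_smul _ (h.right⁻¹).2 v

theorem left_mul_apply {n : ℕ} {L : Type*} [Group L] (g h : Wreath omega012 n L) (x : Level n) :
    (g * h).left x =
      g.left x * h.left ⟨rightInv g x.1, (length_rightInv g x.1).trans x.2⟩ := by
  rfl

theorem rightInv_injective {n : ℕ} {L : Type*} [Group L] {g h : Wreath omega012 n L}
    (hr : ∀ v, rightInv g v = rightInv h v) : g.right = h.right := by
  apply inv_injective
  apply Subtype.ext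
  exact Equiv.ext hr

/-- The word `w` represents the family `h` of elements of the wreath products. -/
def Represents (p q : ∀ n : ℕ+, M →* F n) (w : AltWord M)
    (h : ∀ n : ℕ+, Wreath omega012 n (F n)) : Prop :=
  ∀ n : ℕ+, (∀ x : Level n, (h n).left x = w.conf (p n) (q n) ((n : ℕ) - 1) x.1) ∧
    ∀ v, rightInv (h n) v = w.actInv v

/-- The family `h` is a product of a letter and a lamp. -/
def IsSyllable (p q : ∀ n : ℕ+, M →* F n) (l : Option Letter) (m : M)
    (h : ∀ n : ℕ+, Wreath omega012 n (F n)) : Prop :=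
  ∀ n : ℕ+, (∀ x : Level n, (h n).left x = lampF (p n m) (q n m) ((n : ℕ) - 1) x.1) ∧
    ∀ v, rightInv (h n) v = optFun l v

theorem rightInv_aGen {n : ℕ} {L : Type*} [Group L] (v : List Bool) :
    rightInv (SemidirectProduct.inr (aGen omega012) : Wreath omega012 n L) v = aFun v := rfl

theorem Represents.mul_syllable {p q : ∀ n : ℕ+, M →* F n} {w : AltWord M} {l : Option Letter}
    {m : M} {g h : ∀ n : ℕ+, Wreath omega012 n (F n)} (hg : IsSyllable p q l m g)
    (hh : Represents p q w h) : Represents p q (w.mulHead l m) (g * h) := by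
  intro n
  refine ⟨fun x => ?_, fun v => ?_⟩
  · rw [Pi.mul_apply, left_mul_apply, (hg n).1, (hh n).1, AltWord.conf_mulHead]
    simp only [(hg n).2]
  · rw [Pi.mul_apply, rightInv_mul, (hg n).2, (hh n).2, AltWord.actInv_mulHead]

theorem Represents.mul_a (π : ∀ n, Monoid.Coprod U V →* F n) {p q : ∀ n : ℕ+, M →* F n}
    {w : AltWord M} {h : ∀ n : ℕ+, Wreath omega012 n (F n)} (hh : Represents p q w h) :
    Represents p q (.cons (none, 1) w) ((fun n => marking omega012 π n Gen.a) * h) := by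
  intro n
  refine ⟨fun x => ?_, fun v => ?_⟩
  · rw [Pi.mul_apply, left_mul_apply, (hh n).1, AltWord.conf_cons_one]
    simp only [marking, rightInv_aGen]
    simp
  · rw [Pi.mul_apply, rightInv_mul, (hh n).2]
    simp [marking, rightInv_aGen, AltWord.actInv]

theorem represents_one (p q : ∀ n : ℕ+, M →* F n) :
    Represents p q (.single (none, 1)) (1 : ∀ n : ℕ+, Wreath omega012 n (F n)) := by
  intro n
  refine ⟨fun x => by simp [AltWord.conf], fun v => by simp [rightInv, AltWord.actInv]⟩

theorem marking_inv (π : ∀ n, Monoid.Coprod U V →* F n) (s : Gen U V) :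
    ∃ s', ∀ n, (marking omega012 π n s)⁻¹ = marking omega012 π n s' := by
  cases s with
  | a => exact ⟨.a, fun n => by
      simp only [marking, ← map_inv]; congr 1⟩
  | letter x => exact ⟨.letter x, fun n => by
      simp only [marking, ← map_inv]; congr 1⟩
  | inU u hu => exact ⟨.inU u⁻¹ (inv_ne_one.2 hu), fun n => by
      simp only [marking, ← map_inv, ← Pi.mulSingle_inv]⟩
  | inV v hv => exact ⟨.inV v⁻¹ (inv_ne_one.2 hv), fun n => by
      simp only [marking, ← map_inv, ← Pi.mulSingle_inv]⟩

theorem mem_or_inv_mem_range (π : ∀ n, Monoid.Coprod U V →* F n) {g : Delta omega012 π}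
    (hg : g ∈ Set.range (deltaMarking omega012 π) ∨ g⁻¹ ∈ Set.range (deltaMarking omega012 π)) :
    ∃ s, g = deltaMarking omega012 π s := by
  rcases hg with ⟨s, hs⟩ | ⟨s, hs⟩
  · exact ⟨s, hs.symm⟩
  · obtain ⟨s', hs'⟩ := marking_inv π s
    refine ⟨s', ?_⟩
    rw [← inv_inv g, ← hs]
    exact Subtype.ext (funext hs')

/-- The word is built from the right end: a letter or lamp merges into the head syllable, and `a`
prepends a trivial syllable. Every generator adds weight at most `1`. -/
theorem AltWord.exists_represents {η : ℝ} (hη : η ^ 3 + η ^ 2 + η - 2 = 0)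
    (π : ∀ n, Monoid.Coprod U V →* F n) (p q : ∀ n : ℕ+, M →* F n)
    (hS : ∀ s : Gen U V, s ≠ .a →
      ∃ l m, IsSyllable p q l m (fun n => marking omega012 π n s))
    {r : ℕ} {g : Delta omega012 π} (hg : g ∈ ball (Set.range (deltaMarking omega012 π)) r) :
    ∃ w : AltWord M, w.norm η ≤ r ∧ Represents p q w g.1 := by
  obtain ⟨l, hl, hmem, rfl⟩ := hg
  suffices ∃ w : AltWord M, w.norm η ≤ l.length ∧ Represents p q w l.prod.1 by
    obtain ⟨w, hw, h⟩ := this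
    exact ⟨w, hw.trans (by exact_mod_cast hl), h⟩
  clear hl
  induction l with
  | nil => exact ⟨_, by simp [norm], represents_one p q⟩
  | cons g l ih =>
    obtain ⟨w, hw, h⟩ := ih (fun s hs => hmem s (List.mem_cons_of_mem _ hs))
    obtain ⟨s, rfl⟩ := mem_or_inv_mem_range π (hmem g List.mem_cons_self)
    rw [List.prod_cons, List.length_cons, Nat.cast_succ]
    have hb := root_bounds hη
    by_cases hs : s = .a
    · subst hs
      refine ⟨_, ?_, h.mul_a π⟩
      have : wtA η ≤ 1 := by unfold wtA; nlinarith
      simp only [norm, wt_none]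
      linarith
    · obtain ⟨x, m, hx⟩ := hS s hs
      refine ⟨_, ?_, h.mul_syllable hx⟩
      have : wt η x ≤ 1 := by
        rcases x with _ | _ | _ | _ <;> simp only [wt] <;> nlinarith
      have := norm_mulHead_le hη x m w
      linarith

/-- The lamps at `1ⁿ`. -/
def lampU (π : ∀ n, Monoid.Coprod U V →* F n) (n : ℕ+) : U × V →* F n :=
  (π n).comp (Monoid.Coprod.inl.comp (MonoidHom.fst U V))

/-- The lamps at `1ⁿ⁻¹0`. -/
def lampV (π : ∀ n, Monoid.Coprod U V →* F n) (n : ℕ+) : U × V →* F n :=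
  (π n).comp (Monoid.Coprod.inr.comp (MonoidHom.snd U V))

theorem isSyllable_letter (π : ∀ n, Monoid.Coprod U V →* F n) (x : Letter) :
    IsSyllable (lampU π) (lampV π) (some x) 1 (fun n => marking omega012 π n (.letter x)) :=
  fun n => ⟨fun y => by simp [marking], fun v => rfl⟩

theorem isSyllable_inU (π : ∀ n, Monoid.Coprod U V →* F n) (u : U) (hu : u ≠ 1) :
    IsSyllable (lampU π) (lampV π) none (u, 1) (fun n => marking omega012 π n (.inU u hu)) := by
  refine fun n => ⟨fun y => ?_, fun v => rfl⟩
  have hn : (n : ℕ) - 1 + 1 = n := Nat.succ_pred_eq_of_pos n.pos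
  simp [marking, lampU, lampV, lampF_eq, hn, Pi.mulSingle_apply, vertexOnes, Subtype.ext_iff]

theorem isSyllable_inV (π : ∀ n, Monoid.Coprod U V →* F n) (v : V) (hv : v ≠ 1) :
    IsSyllable (lampU π) (lampV π) none (1, v) (fun n => marking omega012 π n (.inV v hv)) := by
  refine fun n => ⟨fun y => ?_, fun v => rfl⟩
  simp [marking, lampU, lampV, lampF_eq, Pi.mulSingle_apply, vertexOnesZero, Subtype.ext_iff]

theorem isSyllable_marking (π : ∀ n, Monoid.Coprod U V →* F n) (s : Gen U V) (hs : s ≠ .a) :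
    ∃ l m, IsSyllable (lampU π) (lampV π) l m (fun n => marking omega012 π n s) := by
  cases s with
  | a => exact absurd rfl hs
  | letter x => exact ⟨_, _, isSyllable_letter π x⟩
  | inU u hu => exact ⟨_, _, isSyllable_inU π u hu⟩
  | inV v hv => exact ⟨_, _, isSyllable_inV π v hv⟩

/-- If all `F_n` are trivial, lamps carry no information. The four syllables that remain do not
depend on `U` and `V`, and neither will the constant. -/
theorem isSyllable_marking_of_subsingleton [∀ n, Subsingleton (F n)]
    (π : ∀ n, Monoid.Coprod U V →* F n) (s : Gen U V) (hs : s ≠ .a) :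
    ∃ l m, IsSyllable (fun _ => (1 : PUnit →* _)) (fun _ => 1) l m
      (fun n => marking omega012 π n s) := by
  cases s with
  | a => exact absurd rfl hs
  | letter x => exact ⟨some x, 1, fun n => ⟨fun y => Subsingleton.elim _ _, fun v => rfl⟩⟩
  | inU u hu => exact ⟨none, 1, fun n => ⟨fun y => Subsingleton.elim _ _, fun v => rfl⟩⟩
  | inV v hv => exact ⟨none, 1, fun n => ⟨fun y => Subsingleton.elim _ _, fun v => rfl⟩⟩

end Representation

/-! ### Word metrics -/

section WordMetric

variable {G : Type*} [Group G] {S : Set G}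

theorem ball_mono {r s : ℕ} (h : r ≤ s) : ball S r ⊆ ball S s := by
  rintro g ⟨l, hl, h1, h2⟩
  exact ⟨l, hl.trans h, h1, h2⟩

theorem finite_ball (hS : S.Finite) (r : ℕ) : (ball S r).Finite := by
  have hT : (S ∪ S⁻¹).Finite := hS.union hS.inv
  have : Finite (S ∪ S⁻¹ : Set G) := hT
  refine ((List.finite_length_le (S ∪ S⁻¹ : Set G) r).image
    (fun l => (l.map Subtype.val).prod)).subset ?_
  rintro g ⟨l, hl, h1, h2⟩
  refine ⟨l.attach.map (fun s => ⟨s.1, by simpa using h1 s.1 s.2⟩), by simpa using hl, ?_⟩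
  simp [h2]

theorem one_mem_ball (r : ℕ) : (1 : G) ∈ ball S r := ⟨[], by simp, by simp, rfl⟩

theorem growth_zero (S : Set G) : growth S 0 = 1 := by
  have : ball S 0 = {1} := by
    ext g
    constructor
    · rintro ⟨l, hl, -, rfl⟩
      simp [List.eq_nil_of_length_eq_zero (Nat.le_zero.1 hl)]
    · rintro rfl
      exact one_mem_ball 0
  rw [growth, this, Set.ncard_singleton]

theorem mul_mem_ball {g h : G} {r s : ℕ} (hg : g ∈ ball S r) (hh : h ∈ ball S s) :
    g * h ∈ ball S (r + s) := by
  obtain ⟨l, hl, h1, rfl⟩ := hg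
  obtain ⟨l', hl', h1', rfl⟩ := hh
  refine ⟨l ++ l', by simp; omega, ?_, by simp⟩
  intro t ht
  rcases List.mem_append.1 ht with ht | ht
  · exact h1 t ht
  · exact h1' t ht

theorem mem_ball_one {g : G} (hg : g ∈ S) : g ∈ ball S 1 :=
  ⟨[g], by simp, by simp [hg], by simp⟩

theorem growth_mono (hS : S.Finite) {r s : ℕ} (h : r ≤ s) : growth S r ≤ growth S s :=
  Set.ncard_le_ncard (ball_mono h) (finite_ball hS s)

theorem growth_pos (hS : S.Finite) (r : ℕ) : 0 < growth S r :=
  (Set.ncard_pos (finite_ball hS r)).2 ⟨1, one_mem_ball r⟩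

theorem mem_ball_wordLength (hgen : ∀ g, ∃ r, g ∈ ball S r) (g : G) :
    g ∈ ball S (wordLength S g) :=
  Nat.sInf_mem (s := {r | g ∈ ball S r}) (hgen g)

theorem wordLength_le_diam (S : Set G) (g : G) : (wordLength S g : ℕ∞) ≤ diam S :=
  le_iSup (fun g => (wordLength S g : ℕ∞)) g

theorem one_le_diam [Nontrivial G] (hgen : ∀ g, ∃ r, g ∈ ball S r) : 1 ≤ diam S := by
  obtain ⟨g, hg⟩ := exists_ne (1 : G)
  refine le_trans ?_ (wordLength_le_diam S g)
  by_contra h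
  have h0 : wordLength S g = 0 := by
    by_contra h'
    exact h (by exact_mod_cast Nat.one_le_iff_ne_zero.2 h')
  obtain ⟨l, hl, -, rfl⟩ := mem_ball_wordLength hgen g
  rw [h0] at hl
  have hnil : l = [] := List.eq_nil_of_length_eq_zero (by omega)
  exact hg (by rw [hnil, List.prod_nil])

theorem ball_eq_univ_of_diam (hgen : ∀ g, ∃ r, g ∈ ball S r) {D : ℕ} (hD : diam S = D) :
    ball S D = Set.univ := by
  refine Set.eq_univ_of_forall fun g => ball_mono ?_ (mem_ball_wordLength hgen g)
  have := wordLength_le_diam S g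
  rw [hD] at this
  exact_mod_cast this

end WordMetric

section LampGens

variable {U V : Type*} [Group U] [Group V] {F : ℕ+ → Type*} [∀ n, Group (F n)]

theorem finite_lampGens [Finite U] [Finite V] (π : ∀ n, Monoid.Coprod U V →* F n) (n : ℕ+) :
    (lampGens π n).Finite :=
  (Set.finite_range _).union (Set.finite_range _)

theorem exists_mem_ball_lampGens {π : ∀ n, Monoid.Coprod U V →* F n} {n : ℕ+}
    (hπ : Function.Surjective (π n)) (g : F n) : ∃ r, g ∈ ball (lampGens π n) r := by
  obtain ⟨x, rfl⟩ := hπ g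
  induction x using Monoid.Coprod.induction_on with
  | inl u => exact ⟨1, mem_ball_one (Or.inl ⟨u, rfl⟩)⟩
  | inr v => exact ⟨1, mem_ball_one (Or.inr ⟨v, rfl⟩)⟩
  | mul x y hx hy =>
    obtain ⟨r, hr⟩ := hx
    obtain ⟨s, hs⟩ := hy
    exact ⟨r + s, by rw [map_mul]; exact mul_mem_ball hr hs⟩

instance : Fintype Letter :=
  ⟨⟨[Letter.b, Letter.c, Letter.d], by simp⟩, by rintro (_ | _ | _) <;> simp⟩

theorem finite_gen [Finite U] [Finite V] : Finite (Gen U V) := by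
  let f : Gen U V → Option (Letter ⊕ U ⊕ V) := fun s => match s with
    | .a => none
    | .letter x => some (.inl x)
    | .inU u _ => some (.inr (.inl u))
    | .inV v _ => some (.inr (.inr v))
  refine Finite.of_injective f ?_
  rintro (_ | x | ⟨u, hu⟩ | ⟨v, hv⟩) (_ | x' | ⟨u', hu'⟩ | ⟨v', hv'⟩) h <;>
    simp_all [f]

end LampGens

/-! ### Counting -/

/-- The number of functions with values of bounded total size is controlled by the generating
function of the sizes. -/
theorem exists_finset_of_sum_le {ι α : Type*} [Fintype ι] (A : Finset α) (h : α → ℕ)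
    {s L B : ℝ} (hs : 0 ≤ s) (hA : ∀ a, (h a : ℝ) ≤ L → a ∈ A)
    (hB : ∑ a ∈ A, Real.exp (-s * h a) ≤ B) :
    ∃ T : Finset (ι → α), (∀ f : ι → α, ∑ i, (h (f i) : ℝ) ≤ L → f ∈ T) ∧
      (T.card : ℝ) ≤ Real.exp (s * L) * B ^ Fintype.card ι := by
  classical
  refine ⟨(Fintype.piFinset fun _ : ι => A).filter (fun f => ∑ i, (h (f i) : ℝ) ≤ L), ?_, ?_⟩
  · intro f hf
    rw [Finset.mem_filter, Fintype.mem_piFinset]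
    refine ⟨fun i => hA _ (le_trans ?_ hf), hf⟩
    exact Finset.single_le_sum (f := fun i => (h (f i) : ℝ)) (fun j _ => by positivity)
      (Finset.mem_univ i)
  · have h0 : 0 ≤ ∑ a ∈ A, Real.exp (-s * h a) := Finset.sum_nonneg fun a _ => (Real.exp_pos _).le
    calc (((Fintype.piFinset fun _ : ι => A).filter
          (fun f => ∑ i, (h (f i) : ℝ) ≤ L)).card : ℝ)
        = ∑ f ∈ (Fintype.piFinset fun _ : ι => A).filter
          (fun f => ∑ i, (h (f i) : ℝ) ≤ L), 1 := by simp
      _ ≤ ∑ f ∈ (Fintype.piFinset fun _ : ι => A).filter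
          (fun f => ∑ i, (h (f i) : ℝ) ≤ L),
            Real.exp (s * L) * ∏ i, Real.exp (-s * h (f i)) := by
        -- Exponential Chebyshev inequality: on the filtered set the total size is at most `L`, so
        -- each summand on the right is at least `1`.
        refine Finset.sum_le_sum fun f hf => ?_
        rw [← Real.exp_sum, ← Real.exp_add, ← Finset.mul_sum]
        apply Real.one_le_exp
        have := mul_le_mul_of_nonneg_left (Finset.mem_filter.1 hf).2 hs
        linarith
      _ ≤ ∑ f ∈ Fintype.piFinset fun _ : ι => A,
            Real.exp (s * L) * ∏ i, Real.exp (-s * h (f i)) := by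
        refine Finset.sum_le_sum_of_subset_of_nonneg (Finset.filter_subset _ _) ?_
        intros
        positivity
      _ = Real.exp (s * L) * (∑ a ∈ A, Real.exp (-s * h a)) ^ Fintype.card ι := by
        rw [← Finset.mul_sum, Finset.sum_prod_piFinset A (fun _ a => Real.exp (-s * h a))]
        simp
      _ ≤ _ := by gcongr

/-! #### Words -/

namespace AltWord

variable {M : Type*}

/-- A word is a syllable, or a syllable followed by a word. -/
def sumEmb (M : Type*) :
    (Option Letter × M) ⊕ (Option Letter × M) × AltWord M ↪ AltWord M where
  toFun z := match z with
    | .inl s => single s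
    | .inr (s, w) => cons s w
  inj' := by
    rintro (s | ⟨s, w⟩) (s' | ⟨s', w'⟩) h <;> simp_all

/-- The words with at most `N` syllables. -/
def words (M : Type*) [Fintype (Option Letter × M)] : ℕ → Finset (AltWord M)
  | 0 => ∅
  | N + 1 => ((Finset.univ : Finset (Option Letter × M)).disjSum
      ((Finset.univ : Finset (Option Letter × M)) ×ˢ words M N)).map (sumEmb M)

theorem one_le_len (w : AltWord M) : 1 ≤ w.len := by
  cases w <;> simp [len]

theorem mem_words [Fintype (Option Letter × M)] {N : ℕ} {w : AltWord M} (h : w.len ≤ N) :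
    w ∈ words M N := by
  induction N generalizing w with
  | zero => have := w.one_le_len; omega
  | succ N ih =>
    rw [words, Finset.mem_map]
    cases w with
    | single s => exact ⟨.inl s, by simp, rfl⟩
    | cons s w => exact ⟨.inr (s, w), by simp [ih (Nat.le_of_succ_le_succ h)], rfl⟩

/-- With `q` syllables the partial sums satisfy `S_{N+1} = q e^{-s} (1 + S_N)`, and `q e^{-s} ≤ 1/2`
preserves the bound `1`. -/
theorem sum_words_le [Fintype (Option Letter × M)] {s : ℝ}
    (hs : Fintype.card (Option Letter × M) * Real.exp (-s) ≤ 1 / 2) (N : ℕ) :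
    ∑ w ∈ words M N, Real.exp (-s * w.len) ≤ 1 := by
  induction N with
  | zero => simp [words]
  | succ N ih =>
    rw [words, Finset.sum_map, Finset.sum_disjSum, Finset.sum_product]
    have h1 : ∀ x : Option Letter × M,
        Real.exp (-s * (sumEmb M (.inl x)).len) = Real.exp (-s) := fun x => by
      rw [show (sumEmb M (.inl x)).len = 1 from rfl]
      simp
    have h2 : ∀ (x : Option Letter × M) (w : AltWord M),
        Real.exp (-s * (sumEmb M (.inr (x, w))).len) = Real.exp (-s) * Real.exp (-s * w.len) :=
      fun x w => by
        rw [← Real.exp_add, show (sumEmb M (.inr (x, w))).len = w.len + 1 from rfl]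
        congr 1
        push_cast
        ring
    simp only [h1, h2, ← Finset.mul_sum, Finset.sum_const, nsmul_eq_mul, Finset.card_univ]
    rw [← mul_assoc]
    have h3 : 0 ≤ Fintype.card (Option Letter × M) * Real.exp (-s) := by positivity
    nlinarith

end AltWord

theorem exists_finset_words {ι M : Type*} [Fintype ι] [Fintype (Option Letter × M)]
    [Nonempty M] (L : ℝ) :
    ∃ T : Finset (ι → AltWord M),
      (∀ f : ι → AltWord M, ∑ i, ((f i).len : ℝ) ≤ L → f ∈ T) ∧
      (T.card : ℝ) ≤ Real.exp (Real.log (2 * Fintype.card (Option Letter × M)) * L) := by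
  have hq : (1 : ℝ) ≤ Fintype.card (Option Letter × M) := by
    exact_mod_cast Fintype.card_pos (α := Option Letter × M)
  obtain ⟨T, hT, hc⟩ := exists_finset_of_sum_le (ι := ι) (AltWord.words M ⌊L⌋₊) AltWord.len
    (s := Real.log (2 * Fintype.card (Option Letter × M))) (L := L) (B := 1)
    (Real.log_nonneg (by linarith)) (fun w hw => AltWord.mem_words (Nat.le_floor hw))
    (AltWord.sum_words_le (by
      rw [Real.exp_neg, Real.exp_log (by linarith)]
      exact le_of_eq (by field_simp)) _)
  exact ⟨T, hT, by simpa using hc⟩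

/-! #### Concave functions -/

section Concave

variable {Φ : ℝ → ℝ}

theorem mul_le_of_concave (hc : ConcaveOn ℝ (Set.Ici 0) Φ) (h0 : ∀ x, 0 ≤ x → 0 ≤ Φ x)
    {a x : ℝ} (ha0 : 0 ≤ a) (ha1 : a ≤ 1) (hx : 0 ≤ x) : a * Φ x ≤ Φ (a * x) := by
  have h := hc.2 (Set.mem_Ici.2 hx) (Set.mem_Ici.2 le_rfl) ha0 (sub_nonneg.2 ha1) (by ring)
  simp only [smul_eq_mul, mul_zero, add_zero] at h
  have := mul_nonneg (sub_nonneg.2 ha1) (h0 0 le_rfl)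
  linarith

/-- Monotonicity applies below `t`, concavity and `Φ 0 ≥ 0` above. An affine majorant at scale `t`
is what an exponential weight can beat. -/
theorem le_mul_one_add_of_concave (hc : ConcaveOn ℝ (Set.Ici 0) Φ) (h0 : ∀ x, 0 ≤ x → 0 ≤ Φ x)
    (hm : MonotoneOn Φ (Set.Ici 0)) {t x : ℝ} (ht : 0 < t) (hx : 0 ≤ x) :
    Φ x ≤ Φ t * (1 + x / t) := by
  have hΦ := h0 t ht.le
  rcases le_total x t with h | h
  · have h1 := hm (Set.mem_Ici.2 hx) (Set.mem_Ici.2 ht.le) h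
    have : 0 ≤ Φ t * (x / t) := by positivity
    linarith
  · have hx' : 0 < x := ht.trans_le h
    have h1 := mul_le_of_concave hc h0 (a := t / x) (x := x) (by positivity)
      ((div_le_one hx').2 h) hx
    rw [div_mul_cancel₀ _ hx'.ne'] at h1
    have h2 : Φ x ≤ Φ t * (x / t) := by
      rw [div_mul_eq_mul_div, div_le_iff₀ hx'] at h1
      rw [mul_div_assoc', le_div_iff₀ ht]
      linarith
    linarith

end Concave

/-! #### Lamp configurations -/

section Configurations

variable {U V : Type*} [Group U] [Group V] {F : ℕ+ → Type*} [∀ n, Group (F n)]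
  {π : ∀ n, Monoid.Coprod U V →* F n} {C₀ : ℝ} {Φ : ℝ → ℝ}

theorem GrowthAssumption.one_le (hG : GrowthAssumption C₀ Φ π) {t : ℝ} (ht : 1 ≤ t) :
    1 ≤ Φ t := by
  rw [← hG.map_one]
  exact hG.mono (Set.mem_Ici.2 zero_le_one) (Set.mem_Ici.2 (zero_le_one.trans ht)) ht

theorem GrowthAssumption.growth_le (hG : GrowthAssumption C₀ Φ π) [Finite U] [Finite V]
    {n : ℕ+} {l : ℕ} (hl : 1 ≤ l) (hd : (l : ℕ∞) ≤ diam (lampGens π n)) :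
    (growth (lampGens π n) l : ℝ) ≤ Real.exp (C₀ * Φ l) := by
  rw [← Real.log_le_iff_le_exp (by exact_mod_cast growth_pos (finite_lampGens π n) l)]
  exact hG.upper n l hl hd

/-- The contribution of the elements of length `l` to the generating function. -/
theorem GrowthAssumption.card_filter_le (hG : GrowthAssumption C₀ Φ π) [Finite U] [Finite V]
    (hC : 1 < C₀) {n : ℕ+} (hπ : Function.Surjective (π n)) {t : ℝ} (ht : 1 ≤ t)
    (A : Finset (F n)) (l : ℕ) :
    ((A.filter fun g => wordLength (lampGens π n) g = l).card : ℝ) ≤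
      Real.exp (C₀ * (Φ t * (1 + l / t))) := by
  have hgen := exists_mem_ball_lampGens hπ
  have hΦ := hG.one_le ht
  have hsub : ((A.filter fun g => wordLength (lampGens π n) g = l : Finset (F n)) : Set (F n)) ⊆
      ball (lampGens π n) l := by
    intro g hg
    rw [← (Finset.mem_filter.1 (Finset.mem_coe.1 hg)).2]
    exact mem_ball_wordLength hgen g
  have hcard : (A.filter fun g => wordLength (lampGens π n) g = l).card ≤
      growth (lampGens π n) l := by
    rw [← Set.ncard_coe_finset]
    exact Set.ncard_le_ncard hsub (finite_ball (finite_lampGens π n) l)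
  have hpos : 0 ≤ C₀ * (Φ t * (1 + l / t)) := by positivity
  rcases Nat.eq_zero_or_pos l with rfl | hl
  · refine le_trans ?_ (Real.one_le_exp hpos)
    rw [growth_zero] at hcard
    exact_mod_cast hcard
  · by_cases hd : (l : ℕ∞) ≤ diam (lampGens π n)
    · refine le_trans (by exact_mod_cast hcard) ((hG.growth_le hl hd).trans ?_)
      rw [Real.exp_le_exp]
      exact mul_le_mul_of_nonneg_left
        (le_mul_one_add_of_concave hG.concave hG.nonneg hG.mono (by linarith) (by positivity))
        (by linarith)
    · have : (A.filter fun g => wordLength (lampGens π n) g = l) = ∅ := by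
        refine Finset.filter_eq_empty_iff.2 fun g _ hg => hd ?_
        rw [← hg]
        exact wordLength_le_diam _ g
      rw [this]
      simp [Real.exp_nonneg]

/-- The growth assumption speaks of integers only; `1 + t ≤ (1 + ⌊t⌋)²` costs the factor `2`. -/
theorem GrowthAssumption.log_one_add_le (hG : GrowthAssumption C₀ Φ π) (hC : 1 < C₀) {n : ℕ+}
    {t : ℝ} (ht : 1 ≤ t) (hd : (⌊t⌋₊ : ℕ∞) ≤ diam (lampGens π n)) :
    Real.log (1 + t) ≤ 2 * C₀ * Φ t := by
  have hT : 1 ≤ ⌊t⌋₊ := Nat.le_floor (by simpa using ht)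
  have hT' : (1 : ℝ) ≤ ⌊t⌋₊ := by exact_mod_cast hT
  have h1 := hG.log_le n _ hT hd
  have h2 := hG.mono (Set.mem_Ici.2 (by positivity)) (Set.mem_Ici.2 (by linarith))
    (Nat.floor_le (by linarith : 0 ≤ t))
  have h3 : Real.log (1 + t) ≤ 2 * Real.log (1 + ⌊t⌋₊) := by
    rw [← Nat.cast_ofNat, ← Real.log_pow]
    apply Real.log_le_log (by linarith)
    have := Nat.lt_floor_add_one t
    nlinarith
  rw [div_mul_eq_mul_div, one_mul, div_le_iff₀ (by linarith)] at h1
  nlinarith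

/-- The slope `C₀ Φ t / t` of the affine majorant is beaten by `y = Φ t / t ≥ 1 / t`. What remains
is a geometric series, at most `1 + t`, and the logarithmic lower bound on `Φ` absorbs it into the
exponential. -/
theorem GrowthAssumption.sum_exp_le (hG : GrowthAssumption C₀ Φ π) [Finite U] [Finite V]
    (hC : 1 < C₀) {n : ℕ+} (hπ : Function.Surjective (π n)) {t : ℝ} (ht : 1 ≤ t)
    (hd : (⌊t⌋₊ : ℕ∞) ≤ diam (lampGens π n)) (A : Finset (F n)) :
    ∑ g ∈ A, Real.exp (-((C₀ + 1) * Φ t / t) * wordLength (lampGens π n) g) ≤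
      Real.exp (3 * C₀ * Φ t) := by
  have ht0 : 0 < t := by linarith
  have hΦ := hG.one_le ht
  set y : ℝ := Φ t / t with hy
  have hy0 : 0 < y := by positivity
  set N := A.sup (wordLength (lampGens π n)) + 1 with hN
  have hmaps : ∀ g ∈ A, wordLength (lampGens π n) g ∈ Finset.range N := fun g hg =>
    Finset.mem_range.2 (Nat.lt_succ_of_le (Finset.le_sup hg))
  rw [← Finset.sum_fiberwise_of_maps_to hmaps]
  have hterm : ∀ l ∈ Finset.range N,
      ∑ g ∈ A with wordLength (lampGens π n) g = l,
        Real.exp (-((C₀ + 1) * Φ t / t) * wordLength (lampGens π n) g) ≤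
      Real.exp (C₀ * Φ t) * Real.exp (-y) ^ l := by
    intro l _
    have : ∀ g ∈ A.filter (fun g => wordLength (lampGens π n) g = l),
        Real.exp (-((C₀ + 1) * Φ t / t) * wordLength (lampGens π n) g) =
          Real.exp (-((C₀ + 1) * Φ t / t) * l) := fun g hg => by
      rw [(Finset.mem_filter.1 hg).2]
    rw [Finset.sum_congr rfl this, Finset.sum_const, nsmul_eq_mul]
    refine (mul_le_mul_of_nonneg_right (hG.card_filter_le hC hπ ht A l)
      (Real.exp_nonneg _)).trans (le_of_eq ?_)
    rw [← Real.exp_nat_mul, ← Real.exp_add, ← Real.exp_add, hy]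
    congr 1
    field_simp
    ring
  refine (Finset.sum_le_sum hterm).trans ?_
  rw [← Finset.mul_sum]
  have hlt : Real.exp (-y) < 1 := by rw [← Real.exp_zero]; exact Real.exp_lt_exp.2 (by linarith)
  have hgeom : ∑ l ∈ Finset.range N, Real.exp (-y) ^ l ≤ (1 - Real.exp (-y))⁻¹ := by
    rw [← tsum_geometric_of_lt_one (Real.exp_nonneg _) hlt]
    exact (summable_geometric_of_lt_one (Real.exp_nonneg _) hlt).sum_le_tsum _
      (fun _ _ => by positivity)
  have hinv : (1 - Real.exp (-y))⁻¹ ≤ 1 + t := by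
    rw [inv_le_comm₀ (by linarith) (by linarith), Real.exp_neg]
    have h1 : 1 + 1 / t ≤ Real.exp y := by
      have : 1 / t ≤ y := by rw [hy]; gcongr
      linarith [Real.add_one_le_exp y]
    have h2 : (Real.exp y)⁻¹ ≤ (1 + 1 / t)⁻¹ := inv_anti₀ (by positivity) h1
    have h3 : (1 + t)⁻¹ = 1 - (1 + 1 / t)⁻¹ := by field_simp; ring
    linarith
  have hlog := hG.log_one_add_le hC ht hd
  have hexp : 1 + t ≤ Real.exp (2 * C₀ * Φ t) := by
    rwa [← Real.log_le_iff_le_exp (by linarith)]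
  calc Real.exp (C₀ * Φ t) * ∑ l ∈ Finset.range N, Real.exp (-y) ^ l
      ≤ Real.exp (C₀ * Φ t) * Real.exp (2 * C₀ * Φ t) := by
        gcongr
        exact hgeom.trans (hinv.trans hexp)
    _ = Real.exp (3 * C₀ * Φ t) := by
        rw [← Real.exp_add]; congr 1; ring

/-- If the diameter is at most `t`, all functions are taken. Otherwise the tilt `s = (C₀ + 1) Φ t /
t` costs `8 (C₀ + 1) Φ t` per point from the total length and `3 C₀ Φ t` from the generating
function. -/
theorem GrowthAssumption.exists_finset_config (hG : GrowthAssumption C₀ Φ π) [Finite U]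
    [Finite V] (hC : 1 < C₀) {n : ℕ+} [Nontrivial (F n)] (hπ : Function.Surjective (π n))
    (ι : Type*) [Fintype ι] {t : ℝ} (ht : 1 ≤ t) :
    ∃ T : Finset (ι → F n),
      (∀ f : ι → F n, ∑ i, (wordLength (lampGens π n) (f i) : ℝ) ≤ 8 * Fintype.card ι * t →
        f ∈ T) ∧
      (T.card : ℝ) ≤ Real.exp ((11 * C₀ + 8) *
        (Fintype.card ι * Φ (minDiam t (diam (lampGens π n))))) := by
  classical
  have hgen := exists_mem_ball_lampGens hπ
  by_cases hcase : ∃ D : ℕ, diam (lampGens π n) = D ∧ (D : ℝ) ≤ t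
  · obtain ⟨D, hD, hDt⟩ := hcase
    have hmin : minDiam t (diam (lampGens π n)) = D := by
      simp [minDiam, hD, hDt]
    have h1D : 1 ≤ D := by
      have := one_le_diam hgen
      rw [hD] at this
      exact_mod_cast this
    have huniv := ball_eq_univ_of_diam hgen hD
    have hfin := finite_ball (finite_lampGens π n) D
    have hcard := hG.growth_le h1D hD.ge
    have hΦ := hG.one_le (t := D) (by exact_mod_cast h1D)
    refine ⟨Fintype.piFinset fun _ => hfin.toFinset, fun f _ => ?_, ?_⟩
    · rw [Fintype.mem_piFinset]
      intro i
      rw [Set.Finite.mem_toFinset, huniv]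
      trivial
    · rw [Fintype.card_piFinset, Finset.prod_const, Finset.card_univ,
        ← Set.ncard_eq_toFinset_card _ hfin, hmin]
      push_cast
      refine (pow_le_pow_left₀ (by positivity) hcard _).trans ?_
      rw [← Real.exp_nat_mul, Real.exp_le_exp]
      have : 0 ≤ (Fintype.card ι : ℝ) * Φ D := by positivity
      nlinarith
  · push Not at hcase
    have ht0 : 0 < t := by linarith
    have hΦ := hG.one_le ht
    have hd : (⌊t⌋₊ : ℕ∞) ≤ diam (lampGens π n) ∧ minDiam t (diam (lampGens π n)) = t := by
      by_cases htop : diam (lampGens π n) = ⊤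
      · simp [htop, minDiam]
      · lift diam (lampGens π n) to ℕ using htop with D hD
        have hDt := hcase D rfl
        refine ⟨?_, ?_⟩
        · exact_mod_cast (Nat.floor_lt ht0.le).2 hDt |>.le
        · simp [minDiam, hDt.le]
    obtain ⟨T, hT, hc⟩ := exists_finset_of_sum_le (ι := ι)
      (finite_ball (finite_lampGens π n) ⌊8 * Fintype.card ι * t⌋₊).toFinset
      (wordLength (lampGens π n)) (s := (C₀ + 1) * Φ t / t) (L := 8 * Fintype.card ι * t)
      (by positivity)
      (fun g hg => by
        rw [Set.Finite.mem_toFinset]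
        exact ball_mono (Nat.le_floor hg) (mem_ball_wordLength hgen g))
      (hG.sum_exp_le hC hπ ht hd.1 _)
    refine ⟨T, hT, hc.trans (le_of_eq ?_)⟩
    rw [← Real.exp_nat_mul, ← Real.exp_add, hd.2]
    congr 1
    field_simp
    ring

end Configurations

/-! ### The upper bound -/

theorem card_portraits_le (k : ℕ) :
    (Fintype.card ((i : Fin k) → Level i → Bool) : ℝ) ≤ Real.exp (Real.log 2 * 2 ^ k) := by
  have h : Fintype.card ((i : Fin k) → Level i → Bool) = 2 ^ ∑ i ∈ Finset.range k, 2 ^ i := by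
    rw [Fintype.card_pi]
    simp only [Fintype.card_fun, Fintype.card_bool, card_level]
    rw [Finset.prod_pow_eq_pow_sum, Fin.sum_univ_eq_sum_range (fun i => 2 ^ i)]
  have h2 : ∑ i ∈ Finset.range k, 2 ^ i ≤ 2 ^ k := by
    rw [Nat.geomSum_eq le_rfl]
    simp
  rw [h, Real.exp_mul, Real.exp_log two_pos]
  push_cast
  rw [show ((2 : ℝ) ^ ((2 : ℝ) ^ k)) = (2 : ℝ) ^ (2 ^ k : ℕ) by
    rw [← Real.rpow_natCast 2 (2 ^ k)]; norm_num]
  exact pow_le_pow_right₀ one_le_two h2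

section Upper

variable {η : ℝ}

theorem one_lt_two_div (hη : η ^ 3 + η ^ 2 + η - 2 = 0) : 12 / 5 < 2 / η ∧ 2 / η < 5 / 2 := by
  have := root_bounds hη
  constructor
  · rw [lt_div_iff₀ (by linarith)]; linarith
  · rw [div_lt_iff₀ (by linarith)]; linarith

theorem div_two_pow_mul (η : ℝ) (k : ℕ) (r : ℝ) :
    2 ^ k * ((η / 2) ^ k * r) = η ^ k * r := by
  rw [div_pow]
  field_simp

theorem one_le_div_two_pow_mul (hη : η ^ 3 + η ^ 2 + η - 2 = 0) {k : ℕ} {r : ℝ}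
    (h : (2 / η) ^ k ≤ r) : 1 ≤ (η / 2) ^ k * r := by
  have hb := root_bounds hη
  have h0 : 0 < η := by linarith
  have h1 : (η / 2) ^ k * (2 / η) ^ k = 1 := by
    rw [← mul_pow]; field_simp; simp
  rw [← h1]
  gcongr

theorem finite_indexSet (hη : η ^ 3 + η ^ 2 + η - 2 = 0) (F : ℕ+ → Type*) (r : ℕ) :
    (indexSet η F r).Finite := by
  have hl := one_lt_two_div hη
  obtain ⟨N, hN⟩ := pow_unbounded_of_one_lt (r : ℝ) (by linarith : 1 < 2 / η)
  have : (Set.Iio (Nat.succPNat N)).Finite := Set.finite_Iio _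
  refine this.subset fun j hj => ?_
  rw [Set.mem_Iio, ← PNat.coe_lt_coe, Nat.succPNat_coe, Nat.succ_eq_add_one]
  by_contra hlt
  have : (2 / η) ^ N ≤ (2 / η) ^ (j : ℕ) :=
    pow_le_pow_right₀ (by linarith) (by omega)
  linarith [hj.1]

/-- For `(2/η)^n ≤ r` the additive error `2^n` is at most `η^n r` and disappears into the main term.
-/
theorem AltWord.sum_wordLength_conf_le_of_norm_le {M L : Type*} [Group M] [Group L]
    (hη : η ^ 3 + η ^ 2 + η - 2 = 0) (p q : M →* L) (S : Set L) (hp : ∀ m, p m ∈ S)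
    (hq : ∀ m, q m ∈ S) {n : ℕ} (hn : 1 ≤ n) {r : ℝ} (hr : (2 / η) ^ n ≤ r) (w : AltWord M)
    (hw : w.norm η ≤ r) :
    ∑ x : Level n, (wordLength S (w.conf p q (n - 1) x.1) : ℝ) ≤
      8 * 2 ^ n * ((η / 2) ^ n * r) := by
  obtain ⟨k, rfl⟩ : ∃ k, n = k + 1 := ⟨n - 1, by omega⟩
  have hb := root_bounds hη
  have ha := wtA_lower hη
  have h0 : 0 < η := by linarith
  have h1 := sum_wordLength_conf_le p q S hp hq k w
  have h2 := sum_len_secAt_le hη k w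
  have h3 := one_le_div_two_pow_mul hη hr
  have h4 : (2 : ℝ) ^ (k + 1) ≤ η ^ (k + 1) * r := by
    rw [← div_two_pow_mul η]
    exact le_mul_of_one_le_right (by positivity) h3
  have hpk : 0 < η ^ k := by positivity
  have hr0 : 0 ≤ η ^ k * r := by
    have : 0 ≤ r := le_trans (by positivity) hr
    positivity
  have h5 : η ^ k * w.norm η / wtA η ≤ (25 / 11) * (η ^ k * r) := by
    rw [div_le_iff₀ (by linarith)]
    have : η ^ k * w.norm η ≤ η ^ k * r := by gcongr
    nlinarith
  rw [Nat.add_sub_cancel, mul_assoc, div_two_pow_mul η]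
  have h6 : (4 / 5) * (η ^ k * r) ≤ η ^ (k + 1) * r := by
    rw [pow_succ]; nlinarith
  rw [pow_succ 2 k] at h4
  linarith

/-- Conversely, for `r < (2/η)^(k+1)` the main term `η^k r` is itself `O(2^k)`. -/
theorem AltWord.sum_len_secAt_le_of_norm_le {M : Type*} [Group M]
    (hη : η ^ 3 + η ^ 2 + η - 2 = 0) {k : ℕ} {r : ℝ} (hr : r < (2 / η) ^ (k + 1))
    (w : AltWord M) (hw : w.norm η ≤ r) :
    ∑ y : Level k, ((secAt y.1 w).len : ℝ) ≤ 8 * 2 ^ k := by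
  have hb := root_bounds hη
  have hl := one_lt_two_div hη
  have ha := wtA_lower hη
  have h0 : 0 < η := by linarith
  refine (sum_len_secAt_le hη k w).trans ?_
  have h1 : η ^ k * w.norm η ≤ 5 / 2 * 2 ^ k := by
    calc η ^ k * w.norm η ≤ η ^ k * (2 / η) ^ (k + 1) := by gcongr; linarith
      _ = 2 / η * 2 ^ k := by rw [pow_succ, div_pow]; field_simp
      _ ≤ _ := mul_le_mul_of_nonneg_right hl.2.le (by positivity)
  have h2 : η ^ k * w.norm η / wtA η ≤ 6 * 2 ^ k := by
    rw [div_le_iff₀ (by linarith)]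
    have : (0 : ℝ) < 2 ^ k := by positivity
    nlinarith
  linarith

variable {U V M : Type*} [Group U] [Group V] [Group M] {F : ℕ+ → Type*} [∀ n, Group (F n)]

/-- A level outside `J_r` with non-trivial group lies strictly below level `k`, where the sections
on level `k` already determine the lamps. -/
theorem eq_of_represents (hη : η ^ 3 + η ^ 2 + η - 2 = 0) {p q : ∀ n : ℕ+, M →* F n} {r k : ℕ}
    (hk : (2 / η) ^ k ≤ r) {w w' : AltWord M} {g h : ∀ n : ℕ+, Wreath omega012 n (F n)}
    (hg : Represents p q w g) (hh : Represents p q w' h)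
    (hconf : ∀ j ∈ indexSet η F r, (g j).left = (h j).left)
    (hb : ∀ y : List Bool, y.length < k → (w.secAt y).parity = (w'.secAt y).parity)
    (hs : ∀ y : List Bool, y.length = k → w.secAt y = w'.secAt y) : g = h := by
  funext n
  refine SemidirectProduct.ext ?_ (rightInv_injective fun v => ?_)
  · by_cases hn : n ∈ indexSet η F r
    · exact hconf n hn
    · funext x
      by_cases hF : Nontrivial (F n)
      · have hl := one_lt_two_div hη
        have hkn : k ≤ (n : ℕ) - 1 := by
          by_contra hlt
          refine hn ⟨le_trans (pow_le_pow_right₀ (by linarith) (by omega)) hk, hF⟩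
        rw [(hg n).1, (hh n).1]
        exact AltWord.conf_eq_of_secAt _ _ k _ hkn hs x.1
          (by rw [x.2]; exact (Nat.succ_pred_eq_of_pos n.pos).symm)
      · rw [not_nontrivial_iff_subsingleton] at hF
        exact Subsingleton.elim _ _
  · rw [(hg n).2, (hh n).2]
    exact AltWord.actInv_eq_of_secAt k hb hs v

theorem log_deltaGrowth_le [Finite U] [Finite V] [Fintype (Option Letter × M)] {C₀ : ℝ}
    {Φ : ℝ → ℝ} {π : ∀ n, Monoid.Coprod U V →* F n}
    (hη : η ^ 3 + η ^ 2 + η - 2 = 0) (hC : 1 < C₀) (hπ : ∀ n, Function.Surjective (π n))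
    (hG : GrowthAssumption C₀ Φ π) (p q : ∀ n : ℕ+, M →* F n)
    (hp : ∀ n m, p n m ∈ lampGens π n) (hq : ∀ n m, q n m ∈ lampGens π n)
    (hS : ∀ s : Gen U V, s ≠ .a →
      ∃ l m, IsSyllable p q l m (fun n => marking omega012 π n s))
    {r k : ℕ} (hk : (2 / η) ^ k ≤ r) (hk' : r < (2 / η) ^ (k + 1)) :
    Real.log (deltaGrowth π r) ≤
      (11 * C₀ + 8) * (∑ᶠ j ∈ indexSet η F r, term η Φ π r j) +
        (Real.log 2 + 8 * Real.log (2 * Fintype.card (Option Letter × M))) * 2 ^ k := by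
  classical
  have := finite_gen (U := U) (V := V)
  have hfinS : (Set.range (deltaMarking omega012 π)).Finite := Set.finite_range _
  have : Fintype (indexSet η F r) := (finite_indexSet hη F r).fintype
  have hT : ∀ j : indexSet η F r, ∃ T : Finset (Level (j : ℕ+) → F j),
      (∀ f : Level (j : ℕ+) → F j, ∑ x, (wordLength (lampGens π j) (f x) : ℝ) ≤
        8 * 2 ^ (j : ℕ) * ((η / 2) ^ (j : ℕ) * r) → f ∈ T) ∧
      (T.card : ℝ) ≤ Real.exp ((11 * C₀ + 8) * term η Φ π r j) := by
    intro j
    have := j.2.2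
    have h := hG.exists_finset_config hC (hπ j) (Level (j : ℕ+))
      (one_le_div_two_pow_mul hη j.2.1)
    rw [card_level] at h
    push_cast at h
    exact h
  choose T hT hTc using hT
  obtain ⟨T', hT', hTc'⟩ := exists_finset_words (ι := Level k) (M := M) (8 * 2 ^ k)
  have hw : ∀ g : Delta omega012 π, ∃ w : AltWord M,
      g ∈ ball (Set.range (deltaMarking omega012 π)) r →
        w.norm η ≤ r ∧ Represents p q w g.1 := by
    intro g
    by_cases hg : g ∈ ball (Set.range (deltaMarking omega012 π)) r
    · obtain ⟨w, hw⟩ := AltWord.exists_represents hη π p q hS hg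
      exact ⟨w, fun _ => hw⟩
    · exact ⟨.single (none, 1), fun h => absurd h hg⟩
  choose W hW using hw
  -- The code consists of the lamps on the levels in `J_r`, the portrait above level `k` and the
  -- sections on level `k`; it is injective on the ball.
  let enc : Delta omega012 π → ((j : indexSet η F r) → Level (j : ℕ+) → F j) ×
      ((i : Fin k) → Level i → Bool) × (Level k → AltWord M) := fun g =>
    (fun j => (g.1 j).left, fun i y => ((W g).secAt y.1).parity, fun y => (W g).secAt y.1)
  let Z : Finset (((j : indexSet η F r) → Level (j : ℕ+) → F j) ×
      ((i : Fin k) → Level i → Bool) × (Level k → AltWord M)) :=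
    Fintype.piFinset T ×ˢ (Finset.univ ×ˢ T')
  have hle : deltaGrowth π r ≤ Z.card := by
    rw [deltaGrowth, growth, ← Set.ncard_coe_finset]
    refine Set.ncard_le_ncard_of_injOn enc (fun g hg => ?_) (fun g hg h hh he => ?_)
      Z.finite_toSet
    · obtain ⟨hn, hR⟩ := hW g hg
      simp only [Z, Finset.coe_product, Set.mem_prod, Finset.mem_coe, Fintype.mem_piFinset,
        Finset.mem_univ, true_and, enc]
      refine ⟨fun j => hT j _ ?_, hT' _ (AltWord.sum_len_secAt_le_of_norm_le hη hk' _ hn)⟩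
      simp only [(hR j).1]
      exact AltWord.sum_wordLength_conf_le_of_norm_le hη _ _ _ (hp j) (hq j) (j : ℕ+).pos j.2.1 _
        hn
    · simp only [enc, Prod.mk.injEq] at he
      obtain ⟨h1, h2, h3⟩ := he
      refine Subtype.ext (eq_of_represents hη hk (hW g hg).2 (hW h hh).2
        (fun j hj => congrFun h1 ⟨j, hj⟩) (fun y hy => ?_) (fun y hy => ?_))
      · exact congrFun (congrFun h2 ⟨y.length, hy⟩) ⟨y, rfl⟩
      · exact congrFun h3 ⟨y, hy⟩
  have hZ : (Z.card : ℝ) ≤ Real.exp ((11 * C₀ + 8) * (∑ᶠ j ∈ indexSet η F r, term η Φ π r j) +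
        (Real.log 2 + 8 * Real.log (2 * Fintype.card (Option Letter × M))) * 2 ^ k) := by
    rw [← finsum_set_coe_eq_finsum_mem, finsum_eq_sum_of_fintype, Finset.mul_sum, add_mul,
      Real.exp_add, Real.exp_add, Real.exp_sum]
    simp only [Z, Finset.card_product, Fintype.card_piFinset, Finset.card_univ]
    push_cast
    refine mul_le_mul (Finset.prod_le_prod (fun _ _ => by positivity) fun j _ => hTc j)
      (mul_le_mul (card_portraits_le k) (hTc'.trans (le_of_eq ?_)) (by positivity)
        (by positivity)) (by positivity) (by positivity)
    congr 1
    ring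
  rw [Real.log_le_iff_le_exp (by exact_mod_cast growth_pos hfinS r)]
  exact le_trans (by exact_mod_cast hle) hZ

end Upper

/-! ### Words with many independent lamps -/

section Substitution

/-- The substitution `ab ↦ abadac`, `ac ↦ abab`, `ad ↦ acac`, on words `a x₁ a x₂ ⋯ a xₘ`
written as lists `x₁, …, xₘ`. -/
def subst : List Letter → List Letter
  | [] => []
  | Letter.b :: v => Letter.b :: Letter.d :: Letter.c :: subst v
  | Letter.c :: v => Letter.b :: Letter.b :: subst v
  | Letter.d :: v => Letter.c :: Letter.c :: subst v

/-- Weights for which the substitution multiplies the length by `2 / η`. -/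
def substWt (η : ℝ) : List Letter → ℝ
  | [] => 0
  | Letter.b :: v => 1 + substWt η v
  | Letter.c :: v => η + substWt η v
  | Letter.d :: v => η ^ 2 + substWt η v

variable {η : ℝ}

/-- The weights `1, η, η²` form an eigenvector of the substitution: the equation for `b` is `1 + η +
η² = 2 / η`, the cubic, while `c` and `d` give `2` and `2η`. -/
theorem substWt_subst (hη : η ^ 3 + η ^ 2 + η - 2 = 0) (v : List Letter) :
    substWt η (subst v) = 2 / η * substWt η v := by
  have hb := root_bounds hη
  have h0 : η ≠ 0 := by linarith
  have h1 : 2 / η = 1 + η + η ^ 2 := by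
    rw [div_eq_iff h0]; linarith
  rw [h1]
  induction v with
  | nil => simp [subst, substWt]
  | cons x v ih =>
    cases x <;> simp only [subst, substWt, ih]
    · ring
    · linear_combination -hη
    · linear_combination -η * hη

theorem substWt_iterate (hη : η ^ 3 + η ^ 2 + η - 2 = 0) (k : ℕ) (v : List Letter) :
    substWt η (subst^[k] v) = (2 / η) ^ k * substWt η v := by
  induction k with
  | zero => simp
  | succ k ih => rw [Function.iterate_succ_apply', substWt_subst hη, ih, pow_succ]; ring

theorem substWt_bounds (hη : η ^ 3 + η ^ 2 + η - 2 = 0) (v : List Letter) :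
    substWt η v ≤ v.length ∧ (v.length : ℝ) ≤ 2 * substWt η v := by
  obtain ⟨hb₀, hb₁⟩ := root_bounds hη
  induction v with
  | nil => simp [substWt]
  | cons x v ih =>
    obtain ⟨ih₀, ih₁⟩ := ih
    rw [List.length_cons]
    push_cast
    cases x <;> simp only [substWt] <;> constructor <;> nlinarith

theorem length_iterate_subst_le (hη : η ^ 3 + η ^ 2 + η - 2 = 0) (k : ℕ) (v : List Letter) :
    ((subst^[k] v).length : ℝ) ≤ 2 * ((2 / η) ^ k * v.length) := by
  have hb := root_bounds hη
  have hl := one_lt_two_div hη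
  refine (substWt_bounds hη _).2.trans ?_
  rw [substWt_iterate hη]
  have : 0 < (2 / η) ^ k := pow_pos (by linarith) k
  gcongr
  exact (substWt_bounds hη v).1

end Substitution

/-! ### Lamp configurations produced along a word -/

section Reach

variable {M F : Type*} [Group M] [Group F]

/-- The configuration on level `k + 1` of the word `a x₁ m₁ a x₂ m₂ ⋯`. -/
def lampConf (p q : M →* F) (k : ℕ) : List (Letter × M) → List Bool → F
  | [], _ => 1
  | (x, m) :: w, y =>
      lampF (p m) (q m) k (aFun y) * lampConf p q k w (optFun (some x) (aFun y))

/-- Lamps along two copies of a word can be placed independently along its substitution. -/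
theorem exists_lampConf_subst (p q : M →* F) (k : ℕ) (v : List Letter)
    (w₁ w₀ : List (Letter × M)) (h₁ : w₁.map Prod.fst = v) (h₀ : w₀.map Prod.fst = v) :
    ∃ w : List (Letter × M), w.map Prod.fst = subst v ∧
      (∀ x, lampConf p q (k + 1) w (true :: x) = lampConf p q k w₁ x) ∧
      ∀ x, lampConf p q (k + 1) w (false :: x) = lampConf p q k w₀ (aFun x) := by
  induction v generalizing w₁ w₀ with
  | nil =>
    rw [List.map_eq_nil_iff] at h₁ h₀
    subst h₁ h₀
    exact ⟨[], rfl, fun _ => rfl, fun _ => rfl⟩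
  | cons l v ih =>
    obtain ⟨⟨_, m₁⟩, w₁, rfl, rfl, e₁⟩ := List.map_eq_cons_iff.1 h₁
    obtain ⟨⟨l, m₀⟩, w₀, rfl, rfl, e₀⟩ := List.map_eq_cons_iff.1 h₀
    cases l with
    | b =>
      -- Three letters `a` exchange the subtrees, so the remaining words change places. The lamp at
      -- the first syllable serves the subtree at `0`, the one at the second serves the subtree at
      -- `1`; the third stays unlit.
      obtain ⟨w, hw, ht, hf⟩ := ih w₀ w₁ e₀ e₁
      refine ⟨(.b, m₀) :: (.d, m₁) :: (.c, 1) :: w, by simp [subst, hw], fun x => ?_, fun x => ?_⟩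
      · simp_all [lampConf, flips, Letter.next]
      · have : ∀ z, optFun (some Letter.d) (optFun (some Letter.c) z) = optFun (some Letter.b) z :=
          fun z => (optFun_kmul (some .c) (some .d) z).symm
        simp_all [lampConf, flips, Letter.next]
    | c =>
      -- Two letters `a` return to the same subtree, so here no exchange occurs.
      obtain ⟨w, hw, ht, hf⟩ := ih w₁ w₀ e₁ e₀
      refine ⟨(.b, m₀) :: (.b, m₁) :: w, by simp [subst, hw], fun x => ?_, fun x => ?_⟩ <;>
      simp_all [lampConf, flips, Letter.next]
    | d =>
      obtain ⟨w, hw, ht, hf⟩ := ih w₁ w₀ e₁ e₀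
      refine ⟨(.c, m₀) :: (.c, m₁) :: w, by simp [subst, hw], fun x => ?_, fun x => ?_⟩ <;>
      simp_all [lampConf, flips, Letter.next]

/-- The configurations on level `N` given by lamps placed along the word `v`. -/
def reach (p q : M →* F) (N : ℕ) (v : List Letter) : Set (Level N → F) :=
  {f | ∃ w : List (Letter × M), w.map Prod.fst = v ∧
    ∀ x, f x = lampConf p q (N - 1) w x.1}

theorem finite_reach [Finite M] (p q : M →* F) (N : ℕ) (v : List Letter) :
    (reach p q N v).Finite := by
  refine ((List.finite_length_eq (Letter × M) v.length).image
    (fun w (x : Level N) => lampConf p q (N - 1) w x.1)).subset ?_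
  rintro f ⟨w, hw, hf⟩
  exact ⟨w, by simp [← hw], (funext hf).symm⟩

theorem ncard_reach_sq_le [Finite M] (p q : M →* F) {N : ℕ} (hN : 1 ≤ N) (v : List Letter) :
    (reach p q N v).ncard ^ 2 ≤ (reach p q (N + 1) (subst v)).ncard := by
  obtain ⟨k, rfl⟩ : ∃ k, N = k + 1 := ⟨N - 1, by omega⟩
  rw [sq, ← Set.ncard_prod]
  let a' : Level (k + 1) → Level (k + 1) := fun x => ⟨aFun x.1, (length_aFun _).trans x.2⟩
  have ha' : ∀ x, a' (a' x) = x := fun x => Subtype.ext (aFun_aFun _)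
  let join : (Level (k + 1) → F) × (Level (k + 1) → F) → Level (k + 1 + 1) → F := fun z x =>
    let y := (levelCons (k + 1)).symm x
    if y.1 then z.1 y.2 else z.2 (a' y.2)
  have hjoin : ∀ z i x, join z (levelCons (k + 1) (i, x)) = if i then z.1 x else z.2 (a' x) :=
    fun z i x => by simp [join]
  refine Set.ncard_le_ncard_of_injOn join ?_ ?_ (finite_reach p q _ _)
  · rintro ⟨f₁, f₀⟩ ⟨⟨w₁, hw₁, hf₁⟩, ⟨w₀, hw₀, hf₀⟩⟩
    obtain ⟨w, hw, ht, hf⟩ := exists_lampConf_subst p q k v w₁ w₀ hw₁ hw₀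
    refine ⟨w, hw, fun x => ?_⟩
    obtain ⟨⟨i, x⟩, rfl⟩ := (levelCons (k + 1)).surjective x
    rw [hjoin]
    cases i
    · exact (hf₀ _).trans (hf x.1).symm
    · exact (hf₁ _).trans (ht x.1).symm
  · rintro ⟨f₁, f₀⟩ - ⟨g₁, g₀⟩ - h
    have h' : ∀ i x, _ := fun i x => congrFun h (levelCons (k + 1) (i, x))
    simp only [hjoin] at h'
    refine Prod.ext (funext fun x => by simpa using h' true x) (funext fun x => ?_)
    simpa [ha'] using h' false (a' x)

theorem ncard_reach_pow_le [Finite M] (p q : M →* F) {N : ℕ} (hN : 1 ≤ N) (k : ℕ)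
    (v : List Letter) :
    (reach p q N v).ncard ^ 2 ^ k ≤ (reach p q (N + k) (subst^[k] v)).ncard := by
  induction k with
  | zero => simp
  | succ k ih =>
    rw [pow_succ 2, pow_mul, Function.iterate_succ_apply']
    exact (Nat.pow_le_pow_left ih 2).trans (ncard_reach_sq_le p q (by omega) _)

theorem two_le_ncard_reach [Finite M] (p q : M →* F) {N : ℕ} (hN : 1 ≤ N)
    (h : ∃ m, p m ≠ 1 ∨ q m ≠ 1) : 2 ≤ (reach p q N [Letter.b]).ncard := by
  obtain ⟨k, rfl⟩ : ∃ k, N = k + 1 := ⟨N - 1, by omega⟩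
  obtain ⟨m, hm⟩ := h
  refine (Set.one_lt_ncard (finite_reach p q _ _)).2
    ⟨fun x => lampConf p q k [(.b, m)] x.1, ⟨_, rfl, fun _ => rfl⟩,
      fun x => lampConf p q k [(.b, 1)] x.1, ⟨_, rfl, fun _ => rfl⟩, fun heq => ?_⟩
  have h' : ∀ x : List Bool, x.length = k + 1 → lampF (p m) (q m) k x = 1 := fun x hx => by
    have := congrFun heq ⟨aFun x, (length_aFun x).trans hx⟩
    simpa [lampConf] using this
  rcases hm with hm | hm
  · apply hm
    have hne : List.replicate (k + 1) true ≠ List.replicate k true ++ [false] := by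
      rw [List.replicate_succ']
      simp
    simpa [lampF_eq, hne] using h' (List.replicate (k + 1) true) (by simp)
  · apply hm
    have hne : List.replicate k true ++ [false] ≠ List.replicate (k + 1) true := by
      rw [List.replicate_succ']
      simp
    simpa [lampF_eq, hne] using h' (List.replicate k true ++ [false]) (by simp)

end Reach

/-! ### Short elements with prescribed lamps -/

section Lower

variable {U V : Type*} [Group U] [Group V] {F : ℕ+ → Type*} [∀ n, Group (F n)]
  {π : ∀ n, Monoid.Coprod U V →* F n}

theorem IsSyllable.mul {M : Type*} [Group M] {p q : ∀ n : ℕ+, M →* F n} {l l' : Option Letter}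
    {m m' : M} {g h : ∀ n : ℕ+, Wreath omega012 n (F n)} (hg : IsSyllable p q l m g)
    (hh : IsSyllable p q l' m' h) : IsSyllable p q (kmul l l') (m * m') (g * h) := by
  intro n
  refine ⟨fun x => ?_, fun v => ?_⟩
  · rw [Pi.mul_apply, left_mul_apply, (hg n).1, (hh n).1]
    simp only [(hg n).2, lampF_optFun, map_mul, lampF_mul]
  · rw [Pi.mul_apply, rightInv_mul, (hg n).2, (hh n).2, optFun_kmul]

theorem isSyllable_one {M : Type*} [Group M] (p q : ∀ n : ℕ+, M →* F n) :
    IsSyllable p q none 1 (1 : ∀ n : ℕ+, Wreath omega012 n (F n)) :=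
  fun n => ⟨fun x => by simp, fun v => rfl⟩

theorem deltaMarking_mem_ball (π : ∀ n, Monoid.Coprod U V →* F n) (s : Gen U V) :
    deltaMarking omega012 π s ∈ ball (Set.range (deltaMarking omega012 π)) 1 :=
  mem_ball_one ⟨s, rfl⟩

theorem exists_isSyllable (π : ∀ n, Monoid.Coprod U V →* F n) (x : Letter) (m : U × V) :
    ∃ g ∈ ball (Set.range (deltaMarking omega012 π)) 3,
      IsSyllable (lampU π) (lampV π) (some x) m g.1 := by
  have hu : ∃ g ∈ ball (Set.range (deltaMarking omega012 π)) 1,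
      IsSyllable (lampU π) (lampV π) none (m.1, 1) g.1 := by
    by_cases h : m.1 = 1
    · rw [h]
      exact ⟨1, one_mem_ball 1, isSyllable_one _ _⟩
    · exact ⟨_, deltaMarking_mem_ball π (.inU m.1 h), isSyllable_inU π m.1 h⟩
  have hv : ∃ g ∈ ball (Set.range (deltaMarking omega012 π)) 1,
      IsSyllable (lampU π) (lampV π) none (1, m.2) g.1 := by
    by_cases h : m.2 = 1
    · rw [h]
      exact ⟨1, one_mem_ball 1, isSyllable_one _ _⟩
    · exact ⟨_, deltaMarking_mem_ball π (.inV m.2 h), isSyllable_inV π m.2 h⟩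
  obtain ⟨g, hg, hg'⟩ := hu
  obtain ⟨h, hh, hh'⟩ := hv
  refine ⟨_, mul_mem_ball (deltaMarking_mem_ball π (.letter x)) (mul_mem_ball hg hh), ?_⟩
  have := (isSyllable_letter π x).mul (hg'.mul hh')
  simp only [kmul, Prod.mk_mul_mk, one_mul, mul_one] at this
  exact this

/-- Each entry costs at most four generators: `a`, the letter, a lamp from `U` and a lamp from `V`.
-/
theorem exists_left_eq_lampConf (π : ∀ n, Monoid.Coprod U V →* F n)
    (w : List (Letter × (U × V))) :
    ∃ g ∈ ball (Set.range (deltaMarking omega012 π)) (4 * w.length),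
      ∀ (n : ℕ+) (x : Level n),
        (g.1 n).left x = lampConf (lampU π n) (lampV π n) ((n : ℕ) - 1) w x.1 := by
  induction w with
  | nil => exact ⟨1, one_mem_ball _, fun n x => rfl⟩
  | cons s w ih =>
    obtain ⟨x, m⟩ := s
    obtain ⟨h, hh, hw⟩ := ih
    obtain ⟨g, hg, hs⟩ := exists_isSyllable π x m
    refine ⟨deltaMarking omega012 π .a * (g * h), ?_, fun n y => ?_⟩
    · have := mul_mem_ball (deltaMarking_mem_ball π .a) (mul_mem_ball hg hh)
      rw [List.length_cons]
      convert this using 2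
      ring
    · change (marking omega012 π n .a * (g.1 n * h.1 n)).left y = _
      rw [left_mul_apply, left_mul_apply, hw, (hs n).1]
      simp only [(hs n).2, marking, rightInv_aGen, lampConf]
      simp

theorem ncard_reach_le_deltaGrowth [Finite U] [Finite V] (π : ∀ n, Monoid.Coprod U V →* F n)
    (n : ℕ+) (v : List Letter) {r : ℕ} (hr : 4 * v.length ≤ r) :
    (reach (lampU π n) (lampV π n) n v).ncard ≤ deltaGrowth π r := by
  have := finite_gen (U := U) (V := V)
  have hfin := finite_ball (Set.finite_range (deltaMarking omega012 π)) r
  refine le_trans (Set.ncard_le_ncard (t := (fun g : Delta omega012 π => (g.1 n).left) ''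
    ball (Set.range (deltaMarking omega012 π)) r) ?_ (hfin.image _)) (Set.ncard_image_le hfin)
  rintro f ⟨w, hw, hf⟩
  obtain ⟨g, hg, h⟩ := exists_left_eq_lampConf π w
  refine ⟨g, ball_mono (le_trans ?_ hr) hg, funext fun x => (h n x).trans (hf x).symm⟩
  simp [← hw]

/-- The `8` is four generators per letter times the `2` lost in comparing length with `substWt`. -/
theorem pow_mul_log_reach_le {η : ℝ} (hη : η ^ 3 + η ^ 2 + η - 2 = 0) [Finite U] [Finite V]
    (π : ∀ n, Monoid.Coprod U V →* F n) (n : ℕ+) {N k : ℕ} (hN : 1 ≤ N) (hn : (n : ℕ) = N + k)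
    (v : List Letter) {r : ℕ} (hr : 8 * ((2 / η) ^ k * v.length) ≤ r) {B : ℕ} (hB : 1 ≤ B)
    (hv : B ≤ (reach (lampU π n) (lampV π n) N v).ncard) :
    2 ^ k * Real.log B ≤ Real.log (deltaGrowth π r) := by
  have h1 := length_iterate_subst_le hη k v
  have h2 : 4 * (subst^[k] v).length ≤ r := by
    have : (4 * (subst^[k] v).length : ℝ) ≤ r := by linarith
    exact_mod_cast this
  have h3 := ncard_reach_le_deltaGrowth π n _ h2
  have h4 := ncard_reach_pow_le (lampU π n) (lampV π n) hN k v
  rw [← hn] at h4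
  have h5 : B ^ 2 ^ k ≤ deltaGrowth π r := (Nat.pow_le_pow_left hv _).trans (h4.trans h3)
  have h6 : (2 : ℝ) ^ k * Real.log B = Real.log ((B : ℝ) ^ 2 ^ k) := by
    rw [Real.log_pow]; push_cast; ring
  rw [h6]
  apply Real.log_le_log
  · have : (0 : ℝ) < B := by exact_mod_cast hB
    positivity
  · exact_mod_cast h5

theorem log_two_le_log_deltaGrowth [Finite U] [Finite V] (π : ∀ n, Monoid.Coprod U V →* F n)
    {r : ℕ} (hr : 1 ≤ r) : Real.log 2 ≤ Real.log (deltaGrowth π r) := by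
  have := finite_gen (U := U) (V := V)
  have hfin := finite_ball (Set.finite_range (deltaMarking omega012 π)) r
  have h2 : 2 ≤ deltaGrowth π r := by
    refine (Set.one_lt_ncard hfin).2 ⟨1, one_mem_ball r, deltaMarking omega012 π .a,
      ball_mono hr (deltaMarking_mem_ball π .a), fun h => ?_⟩
    have h' : ∀ v, rightInv ((1 : Delta omega012 π).1 1) v =
        rightInv ((deltaMarking omega012 π .a).1 1) v := fun v => by rw [← h]
    have : [true] = aFun [true] := h' [true]
    simp at this
  exact Real.log_le_log two_pos (by exact_mod_cast h2)

theorem exists_lamp_ne_one {n : ℕ+} [Nontrivial (F n)] (hπ : Function.Surjective (π n)) :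
    ∃ m, lampU π n m ≠ 1 ∨ lampV π n m ≠ 1 := by
  by_contra! h
  obtain ⟨g, hg⟩ := exists_ne (1 : F n)
  obtain ⟨x, rfl⟩ := hπ g
  apply hg
  clear hg
  induction x using Monoid.Coprod.induction_on with
  | inl u => exact (h (u, 1)).1
  | inr v => exact (h (1, v)).2
  | mul x y hx hy => rw [map_mul, hx, hy, mul_one]

/-- Seen from the vertex `0`, the word `(ab)^{2l}` meets lamps from `U` and from `V` in turn. A
generator is a product of one of each, with one of them trivial, so two letters spell it. -/
theorem growth_le_ncard_reach [Finite U] [Finite V] (π : ∀ n, Monoid.Coprod U V →* F n) (n : ℕ+)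
    (l : ℕ) : growth (lampGens π n) l ≤
      (reach (lampU π n) (lampV π n) 1 (List.replicate (2 * l) Letter.b)).ncard := by
  have hgen : ∀ s : F n, s ∈ lampGens π n ∨ s⁻¹ ∈ lampGens π n →
      ∃ m m', s = lampU π n m * lampV π n m' := by
    rintro s ((⟨u, rfl⟩ | ⟨v, rfl⟩) | (⟨u, hu⟩ | ⟨v, hv⟩))
    · exact ⟨(u, 1), 1, by simp [lampU]⟩
    · exact ⟨1, (1, v), by simp [lampV]⟩
    · exact ⟨(u⁻¹, 1), 1, by rw [← inv_inv s, ← hu]; simp [lampU]⟩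
    · exact ⟨1, (1, v⁻¹), by rw [← inv_inv s, ← hv]; simp [lampV]⟩
  have key : ∀ (l : ℕ) (L : List (F n)), L.length ≤ l →
      (∀ s ∈ L, s ∈ lampGens π n ∨ s⁻¹ ∈ lampGens π n) →
      ∃ w : List (Letter × (U × V)), w.map Prod.fst = List.replicate (2 * l) Letter.b ∧
        lampConf (lampU π n) (lampV π n) 0 w [false] = L.prod := by
    intro l
    induction l with
    | zero =>
      intro L hL _
      rw [List.eq_nil_of_length_eq_zero (Nat.le_zero.1 hL)]
      exact ⟨[], rfl, rfl⟩
    | succ l ih =>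
      intro L hL hmem
      rw [show 2 * (l + 1) = 2 * l + 1 + 1 by ring, List.replicate_succ, List.replicate_succ]
      cases L with
      | nil =>
        obtain ⟨w, hw, hprod⟩ := ih [] (by simp) (by simp)
        refine ⟨(.b, 1) :: (.b, 1) :: w, by simp [hw], ?_⟩
        simp [lampConf, flips, hprod]
      | cons s L =>
        obtain ⟨w, hw, hprod⟩ := ih L (by simpa using hL)
          (fun s hs => hmem s (List.mem_cons_of_mem _ hs))
        obtain ⟨m, m', hs⟩ := hgen s (hmem s List.mem_cons_self)
        refine ⟨(.b, m) :: (.b, m') :: w, by simp [hw], ?_⟩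
        simp [lampConf, flips, hprod, hs, mul_assoc]
  have hfin := finite_reach (lampU π n) (lampV π n) 1 (List.replicate (2 * l) Letter.b)
  refine le_trans (Set.ncard_le_ncard (t := (fun f : Level 1 → F n => f ⟨[false], rfl⟩) ''
    reach (lampU π n) (lampV π n) 1 (List.replicate (2 * l) Letter.b)) ?_ (hfin.image _))
    (Set.ncard_image_le hfin)
  rintro g ⟨L, hL, hmem, rfl⟩
  obtain ⟨w, hw, hprod⟩ := key l L hL hmem
  exact ⟨fun x => lampConf (lampU π n) (lampV π n) 0 w x.1, ⟨w, hw, fun _ => rfl⟩, hprod⟩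

end Lower

/-! ### The bounds on the growth -/

section Bounds

variable {η : ℝ} {U V : Type*} [Group U] [Group V] {F : ℕ+ → Type*} [∀ n, Group (F n)]
  {π : ∀ n, Monoid.Coprod U V →* F n} {C₀ : ℝ} {Φ : ℝ → ℝ}

theorem two_div_pow_rpow (hη : η ^ 3 + η ^ 2 + η - 2 = 0) (k : ℕ) :
    ((2 / η) ^ k) ^ alpha0 η = (2 : ℝ) ^ k := by
  have hl := one_lt_two_div hη
  have h0 : 0 < 2 / η := by linarith
  have hlog : Real.log (2 / η) ≠ 0 := (Real.log_pos (by linarith)).ne'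
  have h1 : (2 / η) ^ alpha0 η = 2 := by
    rw [Real.rpow_def_of_pos h0, alpha0, mul_div_cancel₀ _ hlog, Real.exp_log two_pos]
  rw [← Real.rpow_natCast, ← Real.rpow_mul h0.le, mul_comm, Real.rpow_mul h0.le, h1,
    Real.rpow_natCast]

theorem alpha0_pos (hη : η ^ 3 + η ^ 2 + η - 2 = 0) : 0 < alpha0 η := by
  have hl := one_lt_two_div hη
  exact div_pos (Real.log_pos one_lt_two) (Real.log_pos (by linarith))

theorem minDiam_le {x : ℝ} (D : ℕ∞) : minDiam x D ≤ x := by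
  unfold minDiam
  split_ifs
  · exact le_rfl
  · exact min_le_left _ _

theorem minDiam_nonneg {x : ℝ} (hx : 0 ≤ x) (D : ℕ∞) : 0 ≤ minDiam x D := by
  unfold minDiam
  split_ifs
  · exact hx
  · exact le_min hx (by positivity)

/-- A single lamp is substituted `k - 3` times: the three omitted steps pay for the factor `8` in
the length, as `(2/η)³ ≥ 8`. For `k < 3` the element `a` alone suffices. -/
theorem two_pow_le_log_deltaGrowth [Finite U] [Finite V] (hη : η ^ 3 + η ^ 2 + η - 2 = 0)
    {n : ℕ+} [Nontrivial (F n)] (hπ : Function.Surjective (π n)) {r k : ℕ} (hk : k ≤ n)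
    (hr : (2 / η) ^ k ≤ r) : 2 ^ k ≤ 16 * Real.log (deltaGrowth π r) := by
  have hl := one_lt_two_div hη
  have hlog2 : 1 / 2 < Real.log 2 := by linarith [Real.log_two_gt_d9]
  have hr1 : 1 ≤ r := by
    have : (1 : ℝ) ≤ r := (one_le_pow₀ (by linarith)).trans hr
    exact_mod_cast this
  have h2 := log_two_le_log_deltaGrowth π hr1
  rcases Nat.lt_or_ge k 3 with h3 | h3
  · have : (2 : ℝ) ^ k ≤ 2 ^ 2 := pow_le_pow_right₀ one_le_two (by omega)
    linarith
  · obtain ⟨i, rfl⟩ : ∃ i, k = i + 3 := ⟨k - 3, by omega⟩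
    have hpos : 0 < (2 / η) ^ i := pow_pos (by linarith) i
    have h8 : (8 : ℝ) ≤ (2 / η) ^ 3 := by
      calc (8 : ℝ) = 2 ^ 3 := by norm_num
        _ ≤ _ := pow_le_pow_left₀ (by norm_num) (by linarith) 3
    have := pow_mul_log_reach_le hη π n (N := n - i) (k := i) (by omega) (by omega) [Letter.b]
      (r := r) (by rw [pow_add] at hr; simp only [List.length_singleton]; push_cast; nlinarith)
      one_le_two (two_le_ncard_reach _ _ (by omega) (exists_lamp_ne_one hπ))
    rw [pow_add]
    push_cast at this
    have hp : (0 : ℝ) < 2 ^ i := by positivity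
    nlinarith

/-- Up to the diameter, concavity gives `Φ(16 l) ≤ 16 Φ(l)`; beyond it, `Φ` is only evaluated at
most at the diameter. -/
theorem GrowthAssumption.phi_minDiam_le [Finite U] [Finite V] (hG : GrowthAssumption C₀ Φ π)
    (hC : 1 < C₀) {n : ℕ+} [Nontrivial (F n)] (hπ : Function.Surjective (π n)) {t : ℝ}
    (ht : 0 ≤ t) {l : ℕ} (hl : 1 ≤ l) (htl : t ≤ 16 * l) :
    Φ (minDiam t (diam (lampGens π n))) ≤ 16 * C₀ * Real.log (growth (lampGens π n) l) := by
  have hgen := exists_mem_ball_lampGens hπ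
  have hmin0 := minDiam_nonneg ht (diam (lampGens π n))
  by_cases hd : (l : ℕ∞) ≤ diam (lampGens π n)
  · have h1 := hG.lower n l hl hd
    rw [div_le_iff₀ (by linarith)] at h1
    have h2 : Φ (minDiam t (diam (lampGens π n))) ≤ Φ (16 * l) :=
      hG.mono hmin0 (Set.mem_Ici.2 (by positivity)) ((minDiam_le _).trans htl)
    have h3 := mul_le_of_concave hG.concave hG.nonneg (a := 1 / 16) (x := 16 * l)
      (by norm_num) (by norm_num) (by positivity)
    rw [show (1 / 16 : ℝ) * (16 * l) = l by ring] at h3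
    linarith
  · have hD : ∃ D : ℕ, diam (lampGens π n) = D := by
      refine ENat.ne_top_iff_exists.1 (fun h => hd (by simp [h])) |>.imp fun D h => h.symm
    obtain ⟨D, hD⟩ := hD
    have hDl : D ≤ l := by
      rw [hD] at hd
      exact_mod_cast (not_le.1 hd).le
    have h1D : 1 ≤ D := by
      have := one_le_diam hgen
      rw [hD] at this
      exact_mod_cast this
    have h1 := hG.lower n D h1D hD.ge
    rw [div_le_iff₀ (by linarith)] at h1
    have h2 : Φ (minDiam t (diam (lampGens π n))) ≤ Φ D := by
      refine hG.mono hmin0 (Set.mem_Ici.2 (by positivity)) ?_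
      simp [minDiam, hD]
    have h3 : Real.log (growth (lampGens π n) D) ≤ Real.log (growth (lampGens π n) l) :=
      Real.log_le_log (by exact_mod_cast growth_pos (finite_lampGens π n) D)
        (by exact_mod_cast growth_mono (finite_lampGens π n) hDl)
    have h4 : 0 ≤ Real.log (growth (lampGens π n) D) := Real.log_natCast_nonneg _
    nlinarith

theorem term_nonneg (hη : η ^ 3 + η ^ 2 + η - 2 = 0) (hG : GrowthAssumption C₀ Φ π) (r : ℕ)
    (j : ℕ+) : 0 ≤ term η Φ π r j := by
  have hb := root_bounds hη
  have h0 : 0 < η := by linarith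
  exact mul_nonneg (by positivity) (hG.nonneg _ (minDiam_nonneg (by positivity) _))

theorem term_le_log_deltaGrowth [Finite U] [Finite V] (hη : η ^ 3 + η ^ 2 + η - 2 = 0)
    (hC : 1 < C₀) (hπ : ∀ n, Function.Surjective (π n)) (hG : GrowthAssumption C₀ Φ π) {r : ℕ}
    {j : ℕ+} (hj : j ∈ indexSet η F r) :
    term η Φ π r j ≤ 256 * C₀ * Real.log (deltaGrowth π r) := by
  obtain ⟨hr, hF⟩ := hj
  have hb := root_bounds hη
  have h0 : 0 < η := by linarith
  have hl := one_lt_two_div hη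
  obtain ⟨k, hk⟩ : ∃ k, (j : ℕ) = k + 1 := ⟨j - 1, (Nat.succ_pred_eq_of_pos j.pos).symm⟩
  set X := (2 / η) ^ k with hX
  have hX0 : 0 < X := pow_pos (by linarith) k
  set t := (η / 2) ^ (j : ℕ) * r with ht
  have htX : t * (2 / η * X) = r := by
    rw [ht, hX, ← pow_succ', ← hk, mul_right_comm, ← mul_pow]
    field_simp
    simp
  have ht0 : 0 ≤ t := by positivity
  have hlog0 : 0 ≤ Real.log (deltaGrowth π r) := Real.log_natCast_nonneg _
  rcases lt_or_ge (r : ℝ) (16 * X) with hlt | hge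
  -- There is no room for a word of positive length on level `1`, but `t ≤ 16` makes the term at
  -- most `16 · 2^j`, which a single lamp already yields.
  · have hw := two_pow_le_log_deltaGrowth hη (hπ j) le_rfl hr
    have ht16 : t ≤ 16 := by
      by_contra hcon
      push Not at hcon
      have h5 : 16 * (1 * X) ≤ t * (2 / η * X) := by
        apply mul_le_mul hcon.le _ (by positivity) ht0
        apply mul_le_mul_of_nonneg_right _ hX0.le
        linarith
      linarith
    have h2 : Φ (minDiam t (diam (lampGens π j))) ≤ Φ 16 :=
      hG.mono (minDiam_nonneg ht0 _) (by norm_num) ((minDiam_le _).trans ht16)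
    have h3 := mul_le_of_concave hG.concave hG.nonneg (a := 1 / 16) (x := 16)
      (by norm_num) (by norm_num) (by norm_num)
    rw [show (1 / 16 : ℝ) * 16 = 1 by norm_num, hG.map_one] at h3
    calc term η Φ π r j ≤ 2 ^ (j : ℕ) * 16 :=
          mul_le_mul_of_nonneg_left (by linarith) (by positivity)
      _ ≤ 256 * C₀ * Real.log (deltaGrowth π r) := by nlinarith
  -- The word `(ab)^{2l}` substituted `j - 1` times costs at most `8 · 2l · X ≤ r`.
  · set l := ⌊(r : ℝ) / (16 * X)⌋₊ with hl'
    have h1l : 1 ≤ l := Nat.le_floor (by rw [Nat.cast_one, one_le_div (by positivity)]; exact hge)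
    have h1l' : (1 : ℝ) ≤ l := by exact_mod_cast h1l
    have hfl : (l : ℝ) * (16 * X) ≤ r := by
      rw [← le_div_iff₀ (by positivity)]
      exact Nat.floor_le (by positivity)
    have hfu : (r : ℝ) < (l + 1) * (16 * X) := by
      rw [← div_lt_iff₀ (by positivity)]
      exact Nat.lt_floor_add_one _
    have htl : t ≤ 16 * l := by
      by_contra hcon
      push Not at hcon
      have h5 : 16 * l * (2 * X) ≤ t * (2 / η * X) := by
        apply mul_le_mul hcon.le _ (by positivity) ht0
        apply mul_le_mul_of_nonneg_right _ hX0.le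
        linarith
      nlinarith
    have h1 := hG.phi_minDiam_le hC (hπ j) ht0 h1l htl
    have h2 := pow_mul_log_reach_le hη π j (N := 1) (k := k) le_rfl (by omega)
      (List.replicate (2 * l) Letter.b) (r := r)
      (by rw [List.length_replicate]; push_cast; linarith)
      (growth_pos (finite_lampGens π j) l) (growth_le_ncard_reach π j l)
    rw [term, ← ht, hk, pow_succ]
    have hp : (0 : ℝ) < 2 ^ k := by positivity
    calc 2 ^ k * 2 * Φ (minDiam t (diam (lampGens π j)))
        ≤ 2 ^ k * 2 * (16 * C₀ * Real.log (growth (lampGens π j) l)) := by gcongr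
      _ = 32 * C₀ * (2 ^ k * Real.log (growth (lampGens π j) l)) := by ring
      _ ≤ 32 * C₀ * Real.log (deltaGrowth π r) := by gcongr
      _ ≤ 256 * C₀ * Real.log (deltaGrowth π r) := by gcongr; norm_num

theorem rpow_alpha0_le_log_deltaGrowth [Finite U] [Finite V] (hη : η ^ 3 + η ^ 2 + η - 2 = 0)
    (hπ : ∀ n, Function.Surjective (π n)) (hinf : {n : ℕ+ | Nontrivial (F n)}.Infinite) (r : ℕ) :
    (r : ℝ) ^ alpha0 η ≤ 32 * Real.log (deltaGrowth π r) := by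
  have hlog0 : 0 ≤ Real.log (deltaGrowth π r) := Real.log_natCast_nonneg _
  have hl := one_lt_two_div hη
  rcases Nat.eq_zero_or_pos r with rfl | hr
  · rw [Nat.cast_zero, Real.zero_rpow (alpha0_pos hη).ne']
    positivity
  · obtain ⟨k, hk, hk'⟩ := exists_nat_pow_near (x := (r : ℝ)) (y := 2 / η)
      (by exact_mod_cast hr) (by linarith)
    -- Infinitely many non-trivial groups guarantee one deep enough for the scale `k` of `r`.
    obtain ⟨n, hn, hkn⟩ := hinf.exists_gt (Nat.succPNat k)
    have hkn' : k ≤ n := by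
      have : ((Nat.succPNat k : ℕ+) : ℕ) < n := hkn
      rw [Nat.succPNat_coe] at this
      omega
    have : Nontrivial (F n) := hn
    have h1 := two_pow_le_log_deltaGrowth hη (hπ n) hkn' hk
    have h2 : (r : ℝ) ^ alpha0 η ≤ 2 ^ (k + 1) := by
      rw [← two_div_pow_rpow hη]
      exact Real.rpow_le_rpow (by positivity) hk'.le (alpha0_pos hη).le
    rw [pow_succ] at h2
    linarith

/-- The constant `288` is `256 + 32`, from the two lower bounds added; it also dominates `11 C₀ +
8`. -/
theorem volumeBounds_of_syllables {M : Type*} [Group M] [Finite U] [Finite V]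
    [Fintype (Option Letter × M)] (hη : η ^ 3 + η ^ 2 + η - 2 = 0) (hC : 1 < C₀)
    (hπ : ∀ n, Function.Surjective (π n)) (hG : GrowthAssumption C₀ Φ π)
    (p q : ∀ n : ℕ+, M →* F n) (hp : ∀ n m, p n m ∈ lampGens π n)
    (hq : ∀ n m, q n m ∈ lampGens π n)
    (hS : ∀ s : Gen U V, s ≠ .a →
      ∃ l m, IsSyllable p q l m (fun n => marking omega012 π n s))
    {C : ℝ} (hC₁ : 288 * C₀ ≤ C)
    (hC₂ : Real.log 2 + 8 * Real.log (2 * Fintype.card (Option Letter × M)) ≤ C) :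
    VolumeBounds η C Φ π := by
  intro r
  have hl := one_lt_two_div hη
  have hC0 : 0 < C := by linarith
  have hlog0 : 0 ≤ Real.log (deltaGrowth π r) := Real.log_natCast_nonneg _
  have hsup : (⨆ j : indexSet η F r, term η Φ π r j) ≤ 256 * C₀ * Real.log (deltaGrowth π r) :=
    Real.iSup_le (fun j => term_le_log_deltaGrowth hη hC hπ hG j.2) (by positivity)
  refine ⟨?_, ?_, fun hinf => ?_⟩
  · have hterm : 0 ≤ ∑ᶠ j ∈ indexSet η F r, term η Φ π r j :=
      finsum_nonneg fun j => finsum_nonneg fun _ => term_nonneg hη hG r j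
    rcases Nat.eq_zero_or_pos r with rfl | hr
    · rw [deltaGrowth, growth_zero, Nat.cast_one, Real.log_one]
      positivity
    · obtain ⟨k, hk, hk'⟩ := exists_nat_pow_near (x := (r : ℝ)) (y := 2 / η)
        (by exact_mod_cast hr) (by linarith)
      refine (log_deltaGrowth_le hη hC hπ hG p q hp hq hS hk hk').trans (add_le_add ?_ ?_)
      · exact mul_le_mul_of_nonneg_right (by linarith) hterm
      · refine mul_le_mul hC₂ ?_ (by positivity) hC0.le
        rw [← two_div_pow_rpow hη]
        exact Real.rpow_le_rpow (pow_nonneg (by linarith) k) hk (alpha0_pos hη).le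
  · rw [one_div, inv_mul_le_iff₀ hC0]
    nlinarith
  · have h := rpow_alpha0_le_log_deltaGrowth hη hπ hinf r
    rw [← mul_add, one_div, inv_mul_le_iff₀ hC0]
    nlinarith

/-- The constant in the bounds, if `|U| + |V| ≤ K`. -/
noncomputable def boundConst (C₀ : ℝ) (K : ℕ) : ℝ :=
  288 * C₀ + Real.log 2 + 8 * Real.log (8 * K ^ 2 + 1)

theorem boundConst_bounds (hC : 1 < C₀) {K N : ℕ} (hN₀ : 0 < N) (hN : N ≤ 4 * K ^ 2) :
    288 * C₀ ≤ boundConst C₀ K ∧ Real.log 2 + 8 * Real.log (2 * N) ≤ boundConst C₀ K := by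
  have h1 : 0 ≤ Real.log 2 := Real.log_nonneg one_le_two
  have hN' : (N : ℝ) ≤ 4 * K ^ 2 := by exact_mod_cast hN
  have hN₀' : (0 : ℝ) < N := by exact_mod_cast hN₀
  have h2 : Real.log (2 * N) ≤ Real.log (8 * K ^ 2 + 1) :=
    Real.log_le_log (by positivity) (by linarith)
  have h3 : 0 ≤ Real.log (8 * (K : ℝ) ^ 2 + 1) := Real.log_nonneg (by nlinarith)
  unfold boundConst
  constructor <;> linarith

theorem boundConst_pos (hC : 1 < C₀) (K : ℕ) : 0 < boundConst C₀ K := by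
  have h1 : 0 ≤ Real.log 2 := Real.log_nonneg one_le_two
  have h3 : 0 ≤ Real.log (8 * (K : ℝ) ^ 2 + 1) := Real.log_nonneg (by nlinarith)
  unfold boundConst
  linarith

theorem volumeBounds_of_card_le [Finite U] [Finite V] (hη : η ^ 3 + η ^ 2 + η - 2 = 0)
    (hC : 1 < C₀) (hπ : ∀ n, Function.Surjective (π n)) (hG : GrowthAssumption C₀ Φ π) {K : ℕ}
    (hK : Nat.card U + Nat.card V ≤ K) : VolumeBounds η (boundConst C₀ K) Φ π := by
  have := Fintype.ofFinite U
  have := Fintype.ofFinite V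
  have hcard : Fintype.card (Option Letter × (U × V)) ≤ 4 * K ^ 2 := by
    have h4 : Fintype.card (Option Letter) = 4 := rfl
    rw [Fintype.card_prod, Fintype.card_prod, h4]
    rw [Nat.card_eq_fintype_card, Nat.card_eq_fintype_card] at hK
    nlinarith
  have hb := boundConst_bounds hC Fintype.card_pos hcard
  exact volumeBounds_of_syllables hη hC hπ hG (lampU π) (lampV π)
    (fun n m => Or.inl ⟨m.1, rfl⟩) (fun n m => Or.inr ⟨m.2, rfl⟩) (isSyllable_marking π) hb.1 hb.2

theorem volumeBounds_of_subsingleton [Finite U] [Finite V] [∀ n, Subsingleton (F n)]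
    (hη : η ^ 3 + η ^ 2 + η - 2 = 0) (hC : 1 < C₀) (hπ : ∀ n, Function.Surjective (π n))
    (hG : GrowthAssumption C₀ Φ π) {K : ℕ} (hK : 1 ≤ K) :
    VolumeBounds η (boundConst C₀ K) Φ π := by
  have hcard : Fintype.card (Option Letter × PUnit.{1}) ≤ 4 * K ^ 2 := by
    have h4 : Fintype.card (Option Letter × PUnit.{1}) = 4 := rfl
    rw [h4]
    nlinarith
  have hb := boundConst_bounds hC Fintype.card_pos hcard
  have hmem : ∀ n (g : F n), g ∈ lampGens π n := fun n g => Or.inl ⟨1, Subsingleton.elim _ _⟩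
  exact volumeBounds_of_syllables hη hC hπ hG (fun _ => (1 : PUnit.{1} →* _)) (fun _ => 1)
    (fun n m => hmem n _) (fun n m => hmem n _) (isSyllable_marking_of_subsingleton π) hb.1 hb.2

/-- The image lies in the ball of radius `1`, whose size is at most `exp (C₀ Φ 1) = exp C₀`. -/
theorem GrowthAssumption.card_le_of_injective [Finite U] [Finite V]
    (hG : GrowthAssumption C₀ Φ π) {n : ℕ+} [Nontrivial (F n)] (hπ : Function.Surjective (π n))
    {W : Type*} (f : W → F n) (hf : Function.Injective f)
    (hmem : ∀ x, f x ∈ lampGens π n) : Nat.card W ≤ ⌈Real.exp C₀⌉₊ := by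
  have h1 := hG.growth_le (n := n) le_rfl
    (by exact_mod_cast one_le_diam (exists_mem_ball_lampGens hπ))
  rw [Nat.cast_one, hG.map_one, mul_one] at h1
  have h2 : Nat.card W ≤ growth (lampGens π n) 1 := by
    rw [growth, ← Set.ncard_univ, ← Set.ncard_image_of_injective _ hf]
    refine Set.ncard_le_ncard ?_ (finite_ball (finite_lampGens π n) 1)
    rintro _ ⟨x, -, rfl⟩
    exact mem_ball_one (hmem x)
  have h3 : (Nat.card W : ℝ) ≤ ⌈Real.exp C₀⌉₊ :=
    le_trans (by exact_mod_cast h2) (h1.trans (Nat.le_ceil _))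
  exact_mod_cast h3

end Bounds

end DiagProd

theorem mainTheorem6 (η : ℝ) (hη : η ^ 3 + η ^ 2 + η - 2 = 0) (C₀ : ℝ) (hC₀ : 1 < C₀) :
    -- constant depending only on `C₀`, if `U` and `V` embed in every non-trivial `F_n`
    (∃ C : ℝ, 0 < C ∧
      ∀ (U V : Type*) [Group U] [Group V] [Finite U] [Finite V] [Nontrivial U] [Nontrivial V]
        (F : ℕ+ → Type*) [∀ n, Group (F n)] (π : ∀ n, Monoid.Coprod U V →* F n) (Φ : ℝ → ℝ),
        (3 ≤ Nat.card U ∨ 3 ≤ Nat.card V) →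
        (∀ n, Function.Surjective (π n)) →
        (∀ n, Nontrivial (F n) →
          Function.Injective (fun u : U => π n (Monoid.Coprod.inl u)) ∧
          Function.Injective (fun v : V => π n (Monoid.Coprod.inr v))) →
        DiagProd.GrowthAssumption C₀ Φ π →
        DiagProd.VolumeBounds η C Φ π) ∧
    -- constant depending only on `C₀` and `|U| + |V|`, for arbitrary marked quotients
    (∀ K : ℕ, ∃ C : ℝ, 0 < C ∧
      ∀ (U V : Type*) [Group U] [Group V] [Finite U] [Finite V] [Nontrivial U] [Nontrivial V]
        (F : ℕ+ → Type*) [∀ n, Group (F n)] (π : ∀ n, Monoid.Coprod U V →* F n) (Φ : ℝ → ℝ),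
        Nat.card U + Nat.card V ≤ K →
        (3 ≤ Nat.card U ∨ 3 ≤ Nat.card V) →
        (∀ n, Function.Surjective (π n)) →
        DiagProd.GrowthAssumption C₀ Φ π →
        DiagProd.VolumeBounds η C Φ π) := by
  refine ⟨⟨DiagProd.boundConst C₀ (⌈Real.exp C₀⌉₊ + ⌈Real.exp C₀⌉₊),
    DiagProd.boundConst_pos hC₀ _, ?_⟩, fun K => ⟨DiagProd.boundConst C₀ K,
    DiagProd.boundConst_pos hC₀ K, ?_⟩⟩
  · intro U V _ _ _ _ _ _ F _ π Φ _ hπ hinj hG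
    by_cases hF : ∃ n, Nontrivial (F n)
    · obtain ⟨n, hn⟩ := hF
      exact DiagProd.volumeBounds_of_card_le hη hC₀ hπ hG
        (add_le_add (hG.card_le_of_injective (hπ n) _ (hinj n hn).1 fun u => Or.inl ⟨u, rfl⟩)
          (hG.card_le_of_injective (hπ n) _ (hinj n hn).2 fun v => Or.inr ⟨v, rfl⟩))
    -- Without a non-trivial `F_n` nothing bounds `|U|` and `|V|`, so the alphabet without lamps is
    -- used.
    · have : ∀ n, Subsingleton (F n) := fun n =>
        not_nontrivial_iff_subsingleton.1 fun h => hF ⟨n, h⟩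
      have h1 : 1 ≤ ⌈Real.exp C₀⌉₊ := Nat.one_le_ceil_iff.2 (Real.exp_pos _)
      exact DiagProd.volumeBounds_of_subsingleton hη hC₀ hπ hG (by omega)
  · intro U V _ _ _ _ _ _ F _ π Φ hK _ hπ hG
    exact DiagProd.volumeBounds_of_card_le hη hC₀ hπ hG hK
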